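/- Let $G$ be a finite group and let $\Sigma$ be a connected two-dimensional CW complex with vertex set $V$, a finite set $E$ of oriented edges (each $q\in E$ running from a vertex $s(q)$ to a vertex $t(q)$), and set of faces $F$, each face $p$ being glued along a closed edge walk $\partial p = q_1^{a_1}\cdots q_k^{a_k}$, $a_i\in\{\pm1\}$, in the 1-skeleton (the attaching map of $p$ may be any continuous loop freely homotopic in the 1-skeleton to this walk). The smooth quantum double code on $\Sigma$ has physical space $\mathbb{C}[G^{E}]$ with basis $|\mathbf g\rangle$, $\mathbf g=(g_q)_{q\in E}\in G^E$, and the following checks. - For every vertex $v$ and every $h\in G$ (no vertex is a ghost vertex), the $X$-check $X_v^h|\mathbf g\rangle=|\mathbf g'\rangle$, where $g'_q$ is obtained from $g_q$ by multiplying by $h$ from the left if $s(q)=v$ and by $h^{-1}$ from the right if $t(q)=v$ (both if $q$ is a loop at $v$). - For every face $p$ with $\partial p = q_1^{a_1}\cdots q_k^{a_k}$, the $Z$-check $Z_{\partial p}|\mathbf g\rangle=|\mathbf g\rangle$ if $g_{q_1}^{a_1}\cdots g_{q_k}^{a_k}=1$, and $Z_{\partial p}|\mathbf g\rangle=0$ otherwise.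 Its codespace is $\mathcal C=\{\psi\in\mathbb{C}[G^{E}] : X_v^h\psi=\psi \text{ and } Z_{\partial p}\psi=\psi \text{ for all } v\in V,\ h\in G,\ p\in F\}$. Then, for every base point $x_0\in\Sigma$, there is an isomorphism of complex vector spaces $$\mathcal C\;\cong\;\mathbb{C}\big[\operatorname{Hom}(\pi_1(\Sigma,x_0),G)/\mathrm{Ad}_G\big],$$ where $\pi_1(\Sigma,x_0)$ is the topological fundamental group, $G$ acts on homomorphisms by conjugation, $\phi^g(\sigma)=g\,\phi(\sigma)\,g^{-1}$, and $\mathbb{C}[S]$ denotes the vector space of formal finite linear combinations of elements of $S$. -/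

import Mathlib

noncomputable section

/-! ### Group qudits, checks, and the codespace of a set of checks -/

/-- The physical Hilbert space `ℂ[G^E]` of `G`-valued qudits labelled by `E`: formal linear
combinations of basis states `|g⟩`, `g : E → G`. -/
abbrev QuditSpace (G E : Type*) := (E → G) →₀ ℂ

/-- The `X`-type operator `X^{k,h}`: the qudit `q` is multiplied by `k q` from the left and by
`(h q)⁻¹` from the right, so that `X^{k,h} |g⟩ = |k g h⁻¹⟩`. -/
def xOperator {G E : Type*} [Group G] (k h : E → G) : QuditSpace G E →ₗ[ℂ] QuditSpace G E :=
  Finsupp.lmapDomain ℂ ℂ (fun g : E → G => k * g * h⁻¹)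

/-- The group element `g_{q₁}^{a₁} ⋯ g_{q_j}^{a_j}` spelled by a list of qudits with
orientations; `true` stands for the orientation `+1` and `false` for `-1`. -/
def groupWord {G E : Type*} [Group G] (g : E → G) (l : List (E × Bool)) : G :=
  (l.map fun a => if a.2 then g a.1 else (g a.1)⁻¹).prod

open Classical in
/-- The `Z`-type operator `Z^K_{q₁ ⋯ q_j}`: it multiplies `|g⟩` by the indicator of
`g_{q₁}^{a₁} ⋯ g_{q_j}^{a_j} ∈ K`. -/
def zOperator {G E : Type*} [Group G] (K : Subgroup G) (l : List (E × Bool)) :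
    QuditSpace G E →ₗ[ℂ] QuditSpace G E :=
  Finsupp.linearCombination ℂ fun g : E → G =>
    if groupWord g l ∈ K then Finsupp.single g (1 : ℂ) else 0

/-- The joint `+1`-eigenspace of a set of checks. -/
def jointFixedSpace {G E : Type*} (checks : Set (QuditSpace G E →ₗ[ℂ] QuditSpace G E)) :
    Submodule ℂ (QuditSpace G E) where
  carrier := {ψ | ∀ T ∈ checks, T ψ = ψ}
  add_mem' := fun {a b} ha hb T hT => by rw [map_add, ha T hT, hb T hT]
  zero_mem' := fun T _ => map_zero T
  smul_mem' := fun c a ha T hT => by rw [map_smul, ha T hT]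

/-! ### Two-dimensional CW complexes with oriented cells -/

/-- The `0`-skeleton: the set of vertices with the discrete topology. -/
def ZeroSkeleton (V : Type*) := V

instance (V : Type*) : TopologicalSpace (ZeroSkeleton V) := ⊥

/-- The cells of dimension at most `1` of a CW complex: vertices `V`, oriented edges `E`, and the
attaching map of each edge, given by its two end points. -/
structure OneComplex (V E : Type*) where
  src : E → V
  tgt : E → V

namespace OneComplex

variable {V E : Type*} (S : OneComplex V E)

/-- The identifications that attach the `1`-cells to the `0`-skeleton. -/
inductive Glue : ZeroSkeleton V ⊕ (Σ _ : E, unitInterval) → ZeroSkeleton V ⊕ (Σ _ : E, unitInterval) → Prop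
  | src (e : E) : Glue (Sum.inr ⟨e, 0⟩) (Sum.inl (S.src e))
  | tgt (e : E) : Glue (Sum.inr ⟨e, 1⟩) (Sum.inl (S.tgt e))

/-- The `1`-skeleton, with the quotient topology. -/
def Space := Quot S.Glue

instance : TopologicalSpace S.Space := inferInstanceAs (TopologicalSpace (Quot S.Glue))

/-- A vertex as a point of the `1`-skeleton. -/
def vertex (v : V) : S.Space := Quot.mk _ (Sum.inl v)

/-- An edge as a path in the `1`-skeleton. -/
def edgePath (e : E) : Path (S.vertex (S.src e)) (S.vertex (S.tgt e)) where
  toFun t := Quot.mk _ (Sum.inr ⟨e, t⟩)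
  continuous_toFun := continuous_quot_mk.comp (continuous_inr.comp continuous_sigmaMk)
  source' := Quot.sound (Glue.src e)
  target' := Quot.sound (Glue.tgt e)

/-- The first vertex of an edge traversed along (`true`) or against (`false`) its orientation. -/
def origin : E × Bool → V
  | (e, true) => S.src e
  | (e, false) => S.tgt e

/-- The last vertex of an edge traversed along (`true`) or against (`false`) its orientation. -/
def terminus : E × Bool → V
  | (e, true) => S.tgt e
  | (e, false) => S.src e

/-- An edge traversed along or against its orientation, as a path. -/
def signedEdgePath : (a : E × Bool) → Path (S.vertex (S.origin a)) (S.vertex (S.terminus a))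
  | (e, true) => S.edgePath e
  | (e, false) => (S.edgePath e).symm

/-- Edge walks: sequences of edges with directions, each starting where the previous one ends. -/
inductive Walk : V → V → Type _
  | nil (v : V) : Walk v v
  | cons (a : E × Bool) {w : V} (rest : Walk (S.terminus a) w) : Walk (S.origin a) w

variable {S}

/-- The sequence of oriented edges of a walk. -/
def Walk.letters : {v w : V} → S.Walk v w → List (E × Bool)
  | _, _, .nil _ => []
  | _, _, .cons a rest => a :: rest.letters

/-- The path in the `1`-skeleton that runs along a walk. -/
def Walk.path : {v w : V} → S.Walk v w → Path (S.vertex v) (S.vertex w)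
  | _, _, .nil v => Path.refl (S.vertex v)
  | _, _, .cons a rest => (S.signedEdgePath a).trans rest.path

end OneComplex

/-- A two-dimensional CW complex with vertices `V`, oriented edges `E` and faces `F`: a
`1`-skeleton together with an arbitrary continuous attaching map from the circle for each face. -/
structure TwoComplex (V E F : Type*) extends OneComplex V E where
  attach : F → C(Circle, toOneComplex.Space)

namespace TwoComplex

variable {V E F : Type*} (S : TwoComplex V E F)

/-- The closed unit disk. -/
abbrev Disk := Metric.closedBall (0 : ℂ) 1

/-- The inclusion of the boundary circle in the closed disk. -/
def boundaryPoint (z : Circle) : Disk := ⟨z, by rw [mem_closedBall_zero_iff, Circle.norm_coe]⟩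

/-- The identifications that attach the `2`-cells to the `1`-skeleton. -/
inductive Glue : S.toOneComplex.Space ⊕ (Σ _ : F, Disk) →
    S.toOneComplex.Space ⊕ (Σ _ : F, Disk) → Prop
  | boundary (p : F) (z : Circle) :
      Glue (Sum.inr ⟨p, boundaryPoint z⟩) (Sum.inl (S.attach p z))

/-- The underlying topological space of the CW complex, with the quotient topology. -/
def Space := Quot S.Glue

instance : TopologicalSpace S.Space := inferInstanceAs (TopologicalSpace (Quot S.Glue))

/-- The attaching map of a face as a loop `t ↦ φ_p(exp(2πit))` in the `1`-skeleton. -/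
def attachLoop (p : F) : Path (S.attach p 1) (S.attach p 1) where
  toFun t := S.attach p (Circle.exp (2 * Real.pi * (t : ℝ)))
  continuous_toFun := by fun_prop
  source' := by simp
  target' := by simp

end TwoComplex

/-! ### Smooth quantum double codes -/

/-- A smooth quantum double code on a two-dimensional CW complex with oriented cells. The qudits
are the edges. Every vertex `v` carries the `X`-checks `X_v^g`, `g ∈ G`; there are no ghost
vertices. Every face `p` carries one `Z`-check, for a closed walk `∂p` in the `1`-skeleton
along which `p` is glued; gluing along `∂p` is understood up to free homotopy of loops in the
`1`-skeleton, so that the attaching maps may be arbitrary continuous loops. -/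
structure SmoothQDCode {V E F : Type*} (S : TwoComplex V E F) where
  base : F → V
  boundary : ∀ p : F, S.toOneComplex.Walk (base p) (base p)
  attach_homotopic : ∀ p : F, ∃ δ : Path (S.attach p 1) (S.toOneComplex.vertex (base p)),
    (S.attachLoop p).Homotopic ((δ.trans (boundary p).path).trans δ.symm)

namespace SmoothQDCode

variable {V E F : Type*} {S : TwoComplex V E F}

open Classical in
/-- The `X`-check `X_v^g`: left multiplication by `g` on the edges going out of `v` and right
multiplication by `g⁻¹` on the edges coming into `v` (conjugation on a loop at `v`). The sets
`{q | src q = v} ⊔ {q | tgt q = v}` partition two copies of the set of qudits. -/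
def xCheck {G : Type*} [Group G] (_ : SmoothQDCode S) (v : V) (g : G) :
    QuditSpace G E →ₗ[ℂ] QuditSpace G E :=
  xOperator (fun q => if S.src q = v then g else 1) (fun q => if S.tgt q = v then g else 1)

/-- The `Z`-check of a face: the projector on trivial holonomy around the boundary walk. -/
def zCheck (G : Type*) [Group G] (C : SmoothQDCode S) (p : F) :
    QuditSpace G E →ₗ[ℂ] QuditSpace G E :=
  zOperator (⊥ : Subgroup G) (C.boundary p).letters

/-- The codespace: the joint `+1`-eigenspace of all `X`-checks and all `Z`-checks. -/
def codespace (G : Type*) [Group G] (C : SmoothQDCode S) : Submodule ℂ (QuditSpace G E) :=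
  jointFixedSpace ({T | ∃ (v : V) (g : G), T = C.xCheck v g} ∪ {T | ∃ p : F, T = C.zCheck G p})

end SmoothQDCode

/-! ### Homomorphisms up to conjugation -/

/-- Two homomorphisms to `G` are related when they differ by conjugation with an element
of `G`. -/
def adSetoid (P G : Type*) [Group P] [Group G] : Setoid (P →* G) where
  r φ ψ := ∃ g : G, ∀ σ : P, ψ σ = g * φ σ * g⁻¹
  iseqv :=
    { refl := fun φ => ⟨1, fun σ => by simp⟩
      symm := fun {φ ψ} ⟨g, h⟩ => ⟨g⁻¹, fun σ => by rw [h]; group⟩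
      trans := fun {φ ψ χ} ⟨g, h⟩ ⟨k, h'⟩ => ⟨k * g, fun σ => by rw [h', h]; group⟩ }

/-- The orbit set `Hom(P, G) / Ad_G`. -/
abbrev HomModAd (P G : Type*) [Group P] [Group G] := Quotient (adSetoid P G)

end

/-! An `X`-check permutes the basis by a gauge transformation, and the `Z`-checks cut out the flat
labellings. Codewords are therefore the functions on flat labellings that are constant on gauge
orbits (`mem_codespace_iff`, `nonempty_linearEquiv_codespace`). It remains to identify flat
labellings modulo gauge with `Hom(π₁, G) / Ad`.

The bridge is the notion of holonomy, a non-abelian singular 1-cocycle: a `G`-valued function on all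
paths, multiplicative on singular triangles. On a path connected space, holonomies modulo gauge are
homomorphisms modulo conjugation (`exists_isHolonomy_toHom`, `exists_gauge_of_toHom`): close up
paths to loops by chosen paths from the base point. On a complex, the values on edges form a flat
labelling. Conversely each flat labelling extends to a holonomy, uniquely up to gauge
(`exists_edgeLabels_eq`, `exists_gauge_of_edgeLabels_eq`).

The extension is local-to-global. By subdivision, a function on paths that is a cocycle on each
member of an open cover determines a unique holonomy agreeing with it on small paths
(`exists_isHolonomy_of_cover`, `ext_of_cover`). A space with cells attached is covered by the open
cells, where coboundaries are used, and the complement of the cell centers, which retracts to the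
lower skeleton. This is applied to the edges and then to the faces; flatness is the condition that
the holonomy of the 1-skeleton is a coboundary on each boundary circle. -/

noncomputable section

open unitInterval Set Topology

/-! ### Holonomies: non-abelian singular cocycles of degree one -/

section Holonomy

variable {X Y N G : Type*} [TopologicalSpace X] [TopologicalSpace Y]
  [Group G] [NormedAddCommGroup N] [NormedSpace ℝ N]

/-- The bottom side of the unit square. -/
def squareBottom : C(I, I × I) := (ContinuousMap.id I).prodMk (ContinuousMap.const I 0)

/-- The right side of the unit square. -/
def squareRight : C(I, I × I) := (ContinuousMap.const I 1).prodMk (ContinuousMap.id I)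

/-- The diagonal of the unit square. -/
def squareDiag : C(I, I × I) := (ContinuousMap.id I).prodMk (ContinuousMap.id I)

/-- A function on paths is a holonomy on `U` if it satisfies the cocycle identity for all
singular triangles (given as singular squares) in `U`. -/
def IsHolonomyOn (U : Set Y) (φ : C(I, Y) → G) : Prop :=
  ∀ ξ : C(I × I, Y), (∀ x, ξ x ∈ U) →
    φ (ξ.comp squareBottom) * φ (ξ.comp squareRight) = φ (ξ.comp squareDiag)

/-- A holonomy is a function on paths that satisfies the cocycle identity on all singular
triangles. -/
abbrev IsHolonomy (φ : C(I, Y) → G) : Prop := IsHolonomyOn univ φ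

/-- The straight path between two points. -/
def segPath (a b : N) : C(I, N) where
  toFun t := a + (t : ℝ) • (b - a)

@[simp] theorem segPath_apply (a b : N) (t : I) : segPath a b t = a + (t : ℝ) • (b - a) := rfl

/-- The square `(s, t) ↦ a + s(b - a) + t(c - b)` has bottom `ab`, right side `bc` and diagonal
`ac`; its image under `τ` must lie in `U` as a whole. -/
theorem IsHolonomyOn.triangle {U : Set Y} {φ : C(I, Y) → G} (hφ : IsHolonomyOn U φ)
    (τ : C(N, Y)) (a b c : N)
    (h : ∀ s t : I, τ (a + (s : ℝ) • (b - a) + (t : ℝ) • (c - b)) ∈ U) :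
    φ (τ.comp (segPath a b)) * φ (τ.comp (segPath b c)) = φ (τ.comp (segPath a c)) := by
  have := hφ ⟨fun x : I × I => τ (a + (x.1 : ℝ) • (b - a) + (x.2 : ℝ) • (c - b)), by fun_prop⟩
    (fun x => h x.1 x.2)
  convert this using 2
  · congr 1; ext t; simp [squareBottom]
  · congr 1; ext t; simp [squareRight]
  · ext t
    change τ (a + (t : ℝ) • (c - a)) = τ (a + (t : ℝ) • (b - a) + (t : ℝ) • (c - b))
    rw [add_assoc, ← smul_add, add_comm (b - a), sub_add_sub_cancel]

theorem IsHolonomy.triangle {φ : C(I, Y) → G} (hφ : IsHolonomy φ) (τ : C(N, Y)) (a b c : N) :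
    φ (τ.comp (segPath a b)) * φ (τ.comp (segPath b c)) = φ (τ.comp (segPath a c)) :=
  IsHolonomyOn.triangle hφ τ a b c fun _ _ => mem_univ _

theorem IsHolonomyOn.const {U : Set Y} {φ : C(I, Y) → G} (hφ : IsHolonomyOn U φ) {y : Y}
    (hy : y ∈ U) : φ (ContinuousMap.const I y) = 1 := by
  have := hφ (ContinuousMap.const _ y) fun _ => hy
  simpa [ContinuousMap.const_comp] using this

theorem IsHolonomy.const {φ : C(I, Y) → G} (hφ : IsHolonomy φ) (y : Y) :
    φ (ContinuousMap.const I y) = 1 := IsHolonomyOn.const hφ (mem_univ y)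

theorem IsHolonomy.comp {φ : C(I, Y) → G} (hφ : IsHolonomy φ) (f : C(X, Y)) :
    IsHolonomy fun γ : C(I, X) => φ (f.comp γ) :=
  fun ξ _ => hφ (f.comp ξ) fun _ => mem_univ _

/-- The gauge transform of a function on paths. -/
def gaugeHol (κ : Y → G) (φ : C(I, Y) → G) : C(I, Y) → G := fun γ => κ (γ 0) * φ γ * (κ (γ 1))⁻¹

theorem IsHolonomyOn.gauge {U : Set Y} {φ : C(I, Y) → G} (hφ : IsHolonomyOn U φ) (κ : Y → G) :
    IsHolonomyOn U (gaugeHol κ φ) := by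
  intro ξ hξ
  simp only [gaugeHol]
  rw [← hφ ξ hξ]
  simp [squareBottom, squareRight, squareDiag, mul_assoc]

theorem gaugeHol_mul (κ κ' : Y → G) (φ : C(I, Y) → G) :
    gaugeHol κ (gaugeHol κ' φ) = gaugeHol (κ * κ') φ := by
  funext γ; simp [gaugeHol, mul_assoc]

theorem isHolonomy_one : IsHolonomy (fun _ : C(I, Y) => (1 : G)) := fun _ _ => by simp

/-- The holonomies around the two halves of the boundary of a square agree. -/
theorem IsHolonomy.square {φ : C(I, Y) → G} (hφ : IsHolonomy φ) (ξ : C(I × I, Y)) :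
    φ (ξ.comp ((ContinuousMap.id I).prodMk (ContinuousMap.const I 0))) *
        φ (ξ.comp ((ContinuousMap.const I 1).prodMk (ContinuousMap.id I))) =
      φ (ξ.comp ((ContinuousMap.const I 0).prodMk (ContinuousMap.id I))) *
        φ (ξ.comp ((ContinuousMap.id I).prodMk (ContinuousMap.const I 1))) := by
  have h1 := hφ ξ fun _ => mem_univ _
  have h2 := hφ (ξ.comp ⟨Prod.swap, continuous_swap⟩) fun _ => mem_univ _
  exact h1.trans h2.symm

/-- The effect of a free homotopy on holonomies. -/
theorem IsHolonomy.homotopy {φ : C(I, Y) → G} (hφ : IsHolonomy φ) (H : C(X × I, Y))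
    (γ : C(I, X)) :
    φ (H.comp (γ.prodMk (ContinuousMap.const I 0))) *
        φ (H.comp ((ContinuousMap.const I (γ 1)).prodMk (ContinuousMap.id I))) =
      φ (H.comp ((ContinuousMap.const I (γ 0)).prodMk (ContinuousMap.id I))) *
        φ (H.comp (γ.prodMk (ContinuousMap.const I 1))) :=
  hφ.square (H.comp (γ.prodMap (ContinuousMap.id I)))

/-- A holonomy on a space with a contraction is a coboundary. -/
theorem IsHolonomy.eq_coboundary {φ : C(I, X) → G} (hφ : IsHolonomy φ) (H : C(X × I, X)) (o : X)
    (h0 : ∀ x, H (x, 0) = o) (h1 : ∀ x, H (x, 1) = x) (γ : C(I, X)) :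
    φ γ = (φ (H.comp ((ContinuousMap.const I (γ 0)).prodMk (ContinuousMap.id I))))⁻¹ *
      φ (H.comp ((ContinuousMap.const I (γ 1)).prodMk (ContinuousMap.id I))) := by
  have := hφ.homotopy H γ
  rw [show H.comp (γ.prodMk (ContinuousMap.const I 0)) = ContinuousMap.const I o by
      ext t; exact h0 _, hφ.const, one_mul,
    show H.comp (γ.prodMk (ContinuousMap.const I 1)) = γ by ext t; exact h1 _] at this
  rw [this, inv_mul_cancel_left]

/-! ### Developing maps: from local to global holonomies -/

/-- The extension of a path to the real line that is constant outside the unit interval. -/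
def extendPath (γ : C(I, Y)) : C(ℝ, Y) :=
  γ.comp ⟨projIcc 0 1 zero_le_one, continuous_projIcc⟩

theorem extendPath_apply (γ : C(I, Y)) (t : ℝ) :
    extendPath γ t = γ (projIcc 0 1 zero_le_one t) := rfl

theorem extendPath_coe (γ : C(I, Y)) (t : I) : extendPath γ t = γ t := by
  rw [extendPath_apply, projIcc_val]

theorem extendPath_segPath (γ : C(I, Y)) : (extendPath γ).comp (segPath 0 1) = γ := by
  ext t; simp [extendPath_coe]

/-- A local developing map on the unit ball for a function on paths that is a holonomy on each
member of an open cover. -/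
theorem exists_developing {ι Q : Type*} [PseudoMetricSpace Q] [CompactSpace Q] (𝒰 : ι → Set Y)
    (hopen : ∀ i, IsOpen (𝒰 i)) (hcov : ∀ y, ∃ i, y ∈ 𝒰 i) {φ : C(I, Y) → G}
    (hφ : ∀ i, IsHolonomyOn (𝒰 i) φ) (f : C(Q, Y)) (π : C(N, Q)) (hπ : LipschitzWith 1 π) :
    ∃ δ > 0, ∃ h : N → G, ∀ a b, ‖a‖ ≤ 1 → ‖b‖ ≤ 1 → ‖b - a‖ < δ →
      h b = h a * φ ((f.comp π).comp (segPath a b)) := by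
  obtain ⟨ε, hε, hball⟩ := lebesgue_number_lemma_of_metric (isCompact_univ (X := Q))
    (c := fun i => f ⁻¹' 𝒰 i) (fun i => (hopen i).preimage f.continuous)
    (fun q _ => mem_iUnion.2 (hcov (f q)))
  -- The parallelogram on a small triangle stays within the Lebesgue number `ε` of `a`, hence in one
  -- member of the cover.
  have key : ∀ a b c : N, ‖b - a‖ + ‖c - b‖ < ε →
      φ ((f.comp π).comp (segPath a b)) * φ ((f.comp π).comp (segPath b c)) =
        φ ((f.comp π).comp (segPath a c)) := by
    intro a b c habc
    obtain ⟨i, hi⟩ := hball (π a) (mem_univ _)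
    refine (hφ i).triangle _ a b c fun s t => ?_
    refine hi (Metric.mem_ball.2 ((hπ.dist_le_mul _ _).trans_lt ?_))
    rw [NNReal.coe_one, one_mul, dist_eq_norm, add_assoc, add_sub_cancel_left]
    refine (norm_add_le _ _).trans_lt (lt_of_le_of_lt ?_ habc)
    rw [norm_smul, norm_smul]
    gcongr
    · rw [Real.norm_of_nonneg s.2.1]; exact mul_le_of_le_one_left (norm_nonneg _) s.2.2
    · rw [Real.norm_of_nonneg t.2.1]; exact mul_le_of_le_one_left (norm_nonneg _) t.2.2
  have key0 : φ ((f.comp π).comp (segPath 0 0)) = 1 := by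
    have := key 0 0 0 (by simpa using hε)
    simpa using this
  obtain ⟨n, hn⟩ := exists_nat_one_div_lt (half_pos hε)
  set r : ℝ := 1 / (n + 1 : ℝ) with hr
  have hr0 : 0 ≤ r := by positivity
  -- `h k x` is the product of `φ` over the first `k` of `n + 1` equal steps on the ray from `0` to
  -- `x`.
  let h : ℕ → N → G := fun k x => Nat.rec 1 (fun k g =>
    g * φ ((f.comp π).comp (segPath ((k * r) • x) (((k + 1 : ℕ) * r) • x)))) k
  have hsucc : ∀ k x, h (k + 1) x = h k x *
    φ ((f.comp π).comp (segPath ((k * r) • x) (((k + 1 : ℕ) * r) • x))) := fun k x => rfl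
  have main : ∀ k ≤ n + 1, ∀ a b, ‖a‖ ≤ 1 → ‖b‖ ≤ 1 → ‖b - a‖ < ε / 2 →
      h k b = h k a * φ ((f.comp π).comp (segPath ((k * r) • a) ((k * r) • b))) := by
    intro k
    induction k with
    | zero => intro _ a b _ _ _; simpa [h] using key0.symm
    | succ k ih =>
      intro hk a b ha hb hab
      have hkr : ∀ j : ℕ, j ≤ n + 1 → ‖((j * r) • b - (j * r) • a)‖ < ε / 2 := by
        intro j hj
        rw [← smul_sub, norm_smul]
        refine lt_of_le_of_lt (mul_le_of_le_one_left (norm_nonneg _) ?_) hab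
        rw [Real.norm_of_nonneg (by positivity), hr, mul_one_div, div_le_one (by positivity)]
        exact_mod_cast hj
      have hstep : ∀ x : N, ‖x‖ ≤ 1 → ‖(((k + 1 : ℕ) * r) • x - (k * r) • x)‖ < ε / 2 := by
        intro x hx
        rw [← sub_smul, norm_smul]
        push_cast
        rw [add_mul, one_mul, add_sub_cancel_left, Real.norm_of_nonneg hr0]
        exact lt_of_le_of_lt (mul_le_of_le_one_right hr0 hx) hn
      -- Neighbouring rays bound a ladder. Both ways around a rung equal `φ` on its diagonal from
      -- `(k * r) • a` to `((k + 1) * r) • b`; the bounds `ε / 2` add up to `ε`.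
      rw [hsucc, hsucc, ih (by omega) a b ha hb hab, mul_assoc, mul_assoc, key, key]
      · linarith [hstep a ha, hkr (k + 1) hk]
      · linarith [hstep b hb, hkr k (by omega)]
  refine ⟨ε / 2, half_pos hε, h (n + 1), fun a b ha hb hab => ?_⟩
  have := main (n + 1) le_rfl a b ha hb hab
  have h1 : ((n + 1 : ℕ) : ℝ) * r = 1 := by rw [hr]; push_cast; field_simp
  rwa [h1, one_smul, one_smul] at this

/-- `h` is a developing map along the path `γ` of the function `φ` on paths. -/
def IsDeveloping (φ : C(I, Y) → G) (γ : C(I, Y)) (h : ℝ → G) : Prop :=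
  ∃ δ > 0, ∀ s ∈ Icc (0 : ℝ) 1, ∀ t ∈ Icc (0 : ℝ) 1, |t - s| < δ →
    h t = h s * φ ((extendPath γ).comp (segPath s t))

/-- Both maps obey the same recursion over steps of length `1 / (n + 1)` below both thresholds. So
the holonomy along `γ` can be defined by any developing map. -/
theorem IsDeveloping.unique {φ : C(I, Y) → G} {γ : C(I, Y)} {h k : ℝ → G}
    (hh : IsDeveloping φ γ h) (hk : IsDeveloping φ γ k) : (h 0)⁻¹ * h 1 = (k 0)⁻¹ * k 1 := by
  obtain ⟨δ, hδ, hh⟩ := hh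
  obtain ⟨δ', hδ', hk⟩ := hk
  obtain ⟨n, hn⟩ := exists_nat_one_div_lt (lt_min hδ hδ')
  have main : ∀ j : ℕ, j ≤ n + 1 → (h 0)⁻¹ * h (j * (1 / (n + 1 : ℝ))) =
      (k 0)⁻¹ * k (j * (1 / (n + 1 : ℝ))) := by
    intro j
    induction j with
    | zero => intro _; simp
    | succ j ih =>
      intro hj
      have mem : ∀ i : ℕ, i ≤ n + 1 → (i * (1 / (n + 1 : ℝ))) ∈ Icc (0 : ℝ) 1 := by
        intro i hi
        refine ⟨by positivity, ?_⟩
        rw [mul_one_div, div_le_one (by positivity)]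
        exact_mod_cast hi
      have hd : |((j + 1 : ℕ) * (1 / (n + 1 : ℝ))) - (j * (1 / (n + 1 : ℝ)))| < min δ δ' := by
        rw [← sub_mul]; push_cast
        rw [add_sub_cancel_left, one_mul, abs_of_nonneg (by positivity)]; exact hn
      rw [hh _ (mem j (by omega)) _ (mem (j + 1) hj) (hd.trans_le (min_le_left _ _)),
        hk _ (mem j (by omega)) _ (mem (j + 1) hj) (hd.trans_le (min_le_right _ _)),
        ← mul_assoc, ← mul_assoc, ih (by omega)]
  have := main (n + 1) le_rfl
  have h1 : ((n + 1 : ℕ) : ℝ) * (1 / (n + 1 : ℝ)) = 1 := by push_cast; field_simp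
  rwa [h1] at this

theorem IsDeveloping.of_forall {φ : C(I, Y) → G} (γ : C(I, Y))
    (h : ∀ s ∈ Icc (0 : ℝ) 1, ∀ t ∈ Icc (0 : ℝ) 1,
      φ ((extendPath γ).comp (segPath 0 s)) * φ ((extendPath γ).comp (segPath s t)) =
        φ ((extendPath γ).comp (segPath 0 t))) :
    IsDeveloping φ γ fun t => φ ((extendPath γ).comp (segPath 0 t)) :=
  ⟨1, one_pos, fun s hs t ht _ => (h s hs t ht).symm⟩

theorem lipschitzWith_projIcc_unit : LipschitzWith 1 (projIcc (0 : ℝ) 1 zero_le_one) :=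
  LipschitzWith.projIcc zero_le_one

/-- Two holonomies that agree on the paths in the members of an open cover are equal. -/
theorem IsHolonomy.ext_of_cover {ι : Type*} (𝒰 : ι → Set Y) (hopen : ∀ i, IsOpen (𝒰 i))
    (hcov : ∀ y, ∃ i, y ∈ 𝒰 i) {φ ψ : C(I, Y) → G} (hφ : IsHolonomy φ) (hψ : IsHolonomy ψ)
    (h : ∀ i, ∀ γ : C(I, Y), (∀ t, γ t ∈ 𝒰 i) → φ γ = ψ γ) : φ = ψ := by
  funext γ
  have main : ∀ χ : C(I, Y) → G, IsHolonomy χ →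
      IsDeveloping χ γ fun t => χ ((extendPath γ).comp (segPath 0 t)) :=
    fun χ hχ => .of_forall γ fun s _ t _ => hχ.triangle _ _ _ _
  -- On short segments `φ` and `ψ` agree, so the map that develops `ψ` also develops `φ`; uniqueness
  -- finishes.
  have hdev : IsDeveloping φ γ fun t => ψ ((extendPath γ).comp (segPath 0 t)) := by
    obtain ⟨ε, hε, hball⟩ := lebesgue_number_lemma_of_metric (isCompact_univ (X := I))
      (c := fun i => γ ⁻¹' 𝒰 i) (fun i => (hopen i).preimage γ.continuous)
      (fun q _ => mem_iUnion.2 (hcov (γ q)))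
    refine ⟨ε, hε, fun s hs t ht hst => ?_⟩
    dsimp only
    rw [← hψ.triangle (extendPath γ) 0 s t]
    congr 1
    obtain ⟨i, hi⟩ := hball ⟨s, hs⟩ (mem_univ _)
    refine (h i _ fun u => ?_).symm
    refine hi (Metric.mem_ball.2 ?_)
    have h1 := lipschitzWith_projIcc_unit.dist_le_mul (segPath s t u) s
    rw [projIcc_of_mem _ hs] at h1
    refine h1.trans_lt ?_
    rw [NNReal.coe_one, one_mul, segPath_apply, dist_eq_norm, add_sub_cancel_left, norm_smul,
      Real.norm_of_nonneg u.2.1]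
    exact (mul_le_of_le_one_left (norm_nonneg _) u.2.2).trans_lt hst
  have := (main φ hφ).unique hdev
  have e0 : ((extendPath γ).comp (segPath 0 0)) = ContinuousMap.const I (γ 0) := by
    ext t; simpa using extendPath_coe γ 0
  simpa [extendPath_segPath, e0, hφ.const, hψ.const] using this

/-- A function on paths that is a holonomy on each member of an open cover extends uniquely
from the small paths to a holonomy. -/
theorem exists_isHolonomy_of_cover {ι : Type*} (𝒰 : ι → Set Y) (hopen : ∀ i, IsOpen (𝒰 i))
    (hcov : ∀ y, ∃ i, y ∈ 𝒰 i) {φ : C(I, Y) → G} (hφ : ∀ i, IsHolonomyOn (𝒰 i) φ) :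
    ∃ ψ : C(I, Y) → G, IsHolonomy ψ ∧ ∀ i, ∀ γ : C(I, Y), (∀ t, γ t ∈ 𝒰 i) → ψ γ = φ γ := by
  have hex : ∀ γ : C(I, Y), ∃ h : ℝ → G, IsDeveloping φ γ h := by
    intro γ
    obtain ⟨δ, hδ, h, hh⟩ := exists_developing 𝒰 hopen hcov hφ γ
      ⟨projIcc (0 : ℝ) 1 zero_le_one, continuous_projIcc⟩ lipschitzWith_projIcc_unit
    refine ⟨h, δ, hδ, fun s hs t ht hst => hh s t ?_ ?_ hst⟩
    · rw [Real.norm_of_nonneg hs.1]; exact hs.2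
    · rw [Real.norm_of_nonneg ht.1]; exact ht.2
  choose h hh using hex
  have val : ∀ γ k, IsDeveloping φ γ k → (h γ 0)⁻¹ * h γ 1 = (k 0)⁻¹ * k 1 :=
    fun γ k hk => (hh γ).unique hk
  refine ⟨fun γ => (h γ 0)⁻¹ * h γ 1, ?_, ?_⟩
  · intro ξ _
    -- The sup-norm unit ball of `ℝ × ℝ` contains the unit square. A developing map `H` there
    -- restricts to one along each side and the diagonal, so all three values are quotients of
    -- values of `H` and telescope.
    obtain ⟨δ, hδ, H, hH⟩ := exists_developing (N := ℝ × ℝ) 𝒰 hopen hcov hφ ξ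
      ⟨Prod.map (projIcc (0 : ℝ) 1 zero_le_one) (projIcc (0 : ℝ) 1 zero_le_one), by fun_prop⟩
      (by
        have := (lipschitzWith_projIcc_unit.comp LipschitzWith.prod_fst).prodMk
          (lipschitzWith_projIcc_unit.comp LipschitzWith.prod_snd)
        rwa [max_self, mul_one] at this)
    have edge : ∀ (a b : ℝ × ℝ) (e : C(I, I × I)), ‖b - a‖ ≤ 1 →
        (∀ t ∈ Icc (0 : ℝ) 1, ‖a + t • (b - a)‖ ≤ 1) →
        (∀ t : I, e t = Prod.map (projIcc (0 : ℝ) 1 zero_le_one) (projIcc (0 : ℝ) 1 zero_le_one)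
          (segPath a b t)) →
        (h (ξ.comp e) 0)⁻¹ * h (ξ.comp e) 1 = (H a)⁻¹ * H b := by
      intro a b e hab hn he
      rw [val _ (fun t => H (a + t • (b - a))) ?_]
      · simp
      refine ⟨δ, hδ, fun s hs t ht hst => ?_⟩
      dsimp only
      rw [hH (a + s • (b - a)) (a + t • (b - a)) (hn s hs) (hn t ht)]
      · congr 2
        ext u
        have hm : s + (u : ℝ) * (t - s) ∈ Icc (0 : ℝ) 1 := by
          have := (convex_Icc (0 : ℝ) 1).add_smul_sub_mem hs ht u.2
          simpa using this
        simp only [ContinuousMap.comp_apply, segPath_apply, extendPath_apply, smul_eq_mul,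
          projIcc_of_mem _ hm, he, ContinuousMap.coe_mk]
        congr 2
        module
      · rw [add_sub_add_left_eq_sub, ← sub_smul, norm_smul]
        exact (mul_le_of_le_one_right (norm_nonneg _) hab).trans_lt hst
    have b1 : ∀ t ∈ Icc (0 : ℝ) 1, |t| ≤ 1 := fun t ht => by rw [abs_of_nonneg ht.1]; exact ht.2
    dsimp only
    rw [edge (0, 0) (1, 0) squareBottom, edge (1, 0) (1, 1) squareRight,
      edge (0, 0) (1, 1) squareDiag]
    · group
    all_goals try simp [Prod.norm_def]
    all_goals try simpa using b1
    all_goals simp [squareBottom, squareRight, squareDiag]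
  · intro i γ hγ
    dsimp only
    rw [val γ _ (.of_forall γ fun s _ t _ => (hφ i).triangle _ _ _ _ fun _ _ => hγ _)]
    have e0 : ((extendPath γ).comp (segPath 0 0)) = ContinuousMap.const I (γ 0) := by
      ext t; simpa using extendPath_coe γ 0
    simp [extendPath_segPath, e0, (hφ i).const (hγ 0)]

end Holonomy

/-! ### Attaching cells -/

/-- A space `Y` obtained from a space `X` by attaching a family of cells `K` along their
boundaries. The cells minus their centers retract to the boundary, by a deformation `deform`
that moves each point of a cell to the boundary point at which it is glued to `retr k : X`. -/
structure CellAttachment (X K Y : Type*) [TopologicalSpace X] [TopologicalSpace K]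
    [TopologicalSpace Y] where
  incl : C(X, Y)
  char : C(K, Y)
  isQuotientMap : IsQuotientMap (Sum.elim incl char)
  incl_injective : Function.Injective incl
  bdry : Set K
  center : Set K
  isClosed_bdry : IsClosed bdry
  isClosed_center : IsClosed center
  notMem_center : ∀ k ∈ bdry, k ∉ center
  retr : K → X
  continuousOn_retr : ContinuousOn retr centerᶜ
  char_eq : ∀ k ∈ bdry, char k = incl (retr k)
  char_inj : ∀ k ∉ bdry, ∀ k' ∉ bdry, char k = char k' → k = k'
  char_ne : ∀ k ∉ bdry, ∀ x, char k ≠ incl x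
  deform : K × I → K
  continuousOn_deform : ContinuousOn deform (centerᶜ ×ˢ univ)
  deform_zero : ∀ k ∉ center, deform (k, 0) = k
  deform_one : ∀ k ∉ center, char (deform (k, 1)) = incl (retr k)
  deform_bdry : ∀ k ∈ bdry, ∀ t, deform (k, t) = k

namespace CellAttachment

variable {X K Y T G : Type*} [TopologicalSpace X] [TopologicalSpace K] [TopologicalSpace Y]
  [TopologicalSpace T] [Group G] (A : CellAttachment X K Y)

/-- Functions on the space and on the cells that agree on the boundary can be glued. -/
theorem exists_glue {T : Type*} (a : X → T) (b : K → T) (h : ∀ k ∈ A.bdry, b k = a (A.retr k)) :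
    ∃ c : Y → T, (∀ x, c (A.incl x) = a x) ∧ ∀ k, c (A.char k) = b k := by
  have hxk : ∀ x k, A.char k = A.incl x → b k = a x := by
    intro x k hk
    by_cases hb : k ∈ A.bdry
    · rw [A.char_eq k hb] at hk
      rw [h k hb, A.incl_injective hk]
    · exact absurd hk (A.char_ne k hb x)
  have hkk : ∀ k k', A.char k = A.char k' → b k = b k' := by
    intro k k' hk
    by_cases hb : k ∈ A.bdry
    · rw [h k hb]
      exact (hxk _ _ (hk.symm.trans (A.char_eq k hb))).symm
    · by_cases hb' : k' ∈ A.bdry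
      · rw [h k' hb']
        exact hxk _ _ (hk.trans (A.char_eq k' hb'))
      · rw [A.char_inj k hb k' hb' hk]
  have hf : Function.FactorsThrough (Sum.elim a b) (Sum.elim A.incl A.char) := by
    rintro (x | k) (x' | k') hz <;> simp only [Sum.elim_inl, Sum.elim_inr] at hz ⊢
    · rw [A.incl_injective hz]
    · exact (hxk _ _ hz.symm).symm
    · exact hxk _ _ hz
    · exact hkk _ _ hz
  refine ⟨Sum.elim a b ∘ Function.surjInv A.isQuotientMap.surjective, fun x => ?_, fun k => ?_⟩
  · exact hf (a := _) (b := .inl x) (Function.surjInv_eq A.isQuotientMap.surjective (A.incl x))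
  · exact hf (a := _) (b := .inr k) (Function.surjInv_eq A.isQuotientMap.surjective (A.char k))

theorem isOpen_of_preimage {U : Set Y} (h1 : IsOpen (A.incl ⁻¹' U)) (h2 : IsOpen (A.char ⁻¹' U)) :
    IsOpen U := by
  rw [← A.isQuotientMap.isOpen_preimage, isOpen_sum_iff]
  exact ⟨h1, h2⟩

theorem exists_rep (y : Y) : (∃ x, A.incl x = y) ∨ ∃ k ∉ A.bdry, A.char k = y := by
  obtain ⟨x | k, h⟩ := A.isQuotientMap.surjective y
  · exact .inl ⟨x, h⟩
  · by_cases hk : k ∈ A.bdry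
    · exact .inl ⟨A.retr k, (A.char_eq k hk).symm.trans h⟩
    · exact .inr ⟨k, hk, h⟩

/-- The complement of the centers of the cells. -/
def punctured : Set Y := (A.char '' A.center)ᶜ

/-- The union of the open cells. -/
def cells : Set Y := (range A.incl)ᶜ

theorem incl_mem_punctured (x : X) : A.incl x ∈ A.punctured := by
  rintro ⟨k, hk, h⟩
  exact A.char_ne k (fun hb => A.notMem_center k hb hk) x h

theorem char_mem_punctured {k : K} : A.char k ∈ A.punctured ↔ k ∉ A.center := by
  refine ⟨fun h hk => h ⟨k, hk, rfl⟩, ?_⟩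
  rintro hk ⟨z, hz, h⟩
  have hz' : z ∉ A.bdry := fun hb => A.notMem_center z hb hz
  by_cases hb : k ∈ A.bdry
  · rw [A.char_eq k hb] at h
    exact A.char_ne z hz' _ h
  · exact hk (A.char_inj z hz' k hb h ▸ hz)

theorem char_mem_cells {k : K} : A.char k ∈ A.cells ↔ k ∉ A.bdry := by
  refine ⟨fun h hk => h ⟨_, (A.char_eq k hk).symm⟩, ?_⟩
  rintro hk ⟨x, h⟩
  exact A.char_ne k hk x h.symm

theorem isOpen_punctured : IsOpen A.punctured := by
  refine A.isOpen_of_preimage ?_ ?_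
  · convert isOpen_univ
    exact eq_univ_of_forall A.incl_mem_punctured
  · convert A.isClosed_center.isOpen_compl
    ext k; exact A.char_mem_punctured

theorem isOpen_cells : IsOpen A.cells := by
  refine A.isOpen_of_preimage ?_ ?_
  · convert isOpen_empty
    exact eq_empty_of_forall_notMem fun x h => h ⟨x, rfl⟩
  · convert A.isClosed_bdry.isOpen_compl
    ext k; exact A.char_mem_cells

/-- The open cover of `Y` by the punctured space and the open cells. -/
def cover : Bool → Set Y := fun b => bif b then A.punctured else A.cells

theorem isOpen_cover (b : Bool) : IsOpen (A.cover b) := by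
  cases b
  exacts [A.isOpen_cells, A.isOpen_punctured]

theorem exists_mem_cover (y : Y) : ∃ b, y ∈ A.cover b := by
  rcases A.exists_rep y with ⟨x, rfl⟩ | ⟨k, hk, rfl⟩
  · exact ⟨true, A.incl_mem_punctured x⟩
  · exact ⟨false, A.char_mem_cells.2 hk⟩

/-- The punctured space is open, so continuity on it can be tested on preimages in `X` and in the
punctured cells. -/
theorem continuousOn_punctured {c : Y → T} (h1 : Continuous fun x => c (A.incl x))
    (h2 : ContinuousOn (fun k => c (A.char k)) A.centerᶜ) : ContinuousOn c A.punctured := by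
  rw [continuousOn_open_iff A.isOpen_punctured]
  intro t ht
  refine A.isOpen_of_preimage ?_ ?_
  · convert ht.preimage h1 using 1
    ext x; simp [A.incl_mem_punctured]
  · convert h2.isOpen_inter_preimage A.isClosed_center.isOpen_compl ht using 1
    ext k; simp [A.char_mem_punctured]

/-- The characteristic map is an open embedding on the open cells, so continuity of the lift is
automatic. -/
theorem exists_lift_of_mem_cells (γ : C(I, Y)) (h : ∀ t, γ t ∈ A.cells) :
    ∃ β : C(I, K), A.char.comp β = γ ∧ ∀ t, β t ∉ A.bdry := by
  have hemb : IsOpenEmbedding fun k : (A.bdryᶜ : Set K) => A.char k := by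
    refine .of_continuous_injective_isOpenMap (by fun_prop) ?_ ?_
    · intro k k' hkk
      exact Subtype.ext (A.char_inj _ k.2 _ k'.2 hkk)
    · intro O hO
      have hO' := (A.isClosed_bdry.isOpen_compl.isOpenMap_subtype_val O hO)
      refine A.isOpen_of_preimage ?_ ?_
      · convert isOpen_empty
        refine eq_empty_of_forall_notMem ?_
        rintro x ⟨k, _, hk⟩
        exact A.char_ne k k.2 x hk
      · convert hO'
        ext k
        constructor
        · rintro ⟨k', hk', h⟩
          refine ⟨k', hk', A.char_inj _ k'.2 _ ?_ h⟩
          exact A.char_mem_cells.1 (h ▸ A.char_mem_cells.2 k'.2)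
        · rintro ⟨k', hk', rfl⟩
          exact ⟨k', hk', rfl⟩
  have hex : ∀ t, ∃ k : (A.bdryᶜ : Set K), A.char k = γ t := by
    intro t
    rcases A.exists_rep (γ t) with ⟨x, hx⟩ | ⟨k, hk, hk'⟩
    · exact absurd ⟨x, hx⟩ (h t)
    · exact ⟨⟨k, hk⟩, hk'⟩
  choose β hβ using hex
  have hc : Continuous β := by
    rw [hemb.isEmbedding.continuous_iff]
    convert γ.continuous using 1
    funext t; exact hβ t
  exact ⟨⟨fun t => β t, by fun_prop⟩, ContinuousMap.ext hβ, fun t => (β t).2⟩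

open Classical in
/-- A holonomy on `X` extends to `Y` if its pull-back to the boundary of the cells is a
coboundary. -/
theorem exists_isHolonomy {φ : C(I, X) → G} (hφ : IsHolonomy φ) (u : K → G)
    (hu : ∀ β : C(I, K), (∀ t, β t ∉ A.center) → ∀ α : C(I, X), (∀ t, α t = A.retr (β t)) →
      φ α = (u (β 0))⁻¹ * u (β 1)) :
    ∃ ψ : C(I, Y) → G, IsHolonomy ψ ∧ (∀ α, ψ (A.incl.comp α) = φ α) ∧
      ∀ β, ψ (A.char.comp β) = (u (β 0))⁻¹ * u (β 1) := by
  obtain ⟨r, hri, hrc⟩ := A.exists_glue id A.retr fun _ _ => rfl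
  have hr : ContinuousOn r A.punctured := A.continuousOn_punctured
    (by simpa [hri] using continuous_id') (by simpa [hrc] using A.continuousOn_retr)
  -- The value `1` on the boundary only makes `u` descend to `Y`; `v` matters on the open cells.
  obtain ⟨v, -, hv⟩ := A.exists_glue (fun _ => (1 : G)) (fun k => if k ∈ A.bdry then 1 else u k)
    fun k hk => if_pos hk
  -- Punctured paths get `φ` of their retraction, all others the coboundary of `v`. By `hu` the two
  -- rules agree on punctured paths in open cells, so `χ` is a holonomy on both members of the
  -- cover.
  let χ : C(I, Y) → G := fun γ =>
    if h : (∀ t, γ t ∈ A.punctured) ∧ ∃ α : C(I, X), ∀ t, α t = r (γ t) then φ h.2.choose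
    else (v (γ 0))⁻¹ * v (γ 1)
  have χp : ∀ γ : C(I, Y), (∀ t, γ t ∈ A.punctured) → ∀ α : C(I, X), (∀ t, α t = r (γ t)) →
      χ γ = φ α := by
    intro γ hγ α hα
    have h : (∀ t, γ t ∈ A.punctured) ∧ ∃ α : C(I, X), ∀ t, α t = r (γ t) := ⟨hγ, α, hα⟩
    simp only [χ, dif_pos h]
    congr 1
    ext t
    rw [h.2.choose_spec, hα]
  have χc : ∀ γ : C(I, Y), (∀ t, γ t ∈ A.cells) → χ γ = (v (γ 0))⁻¹ * v (γ 1) := by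
    intro γ hγ
    by_cases h : (∀ t, γ t ∈ A.punctured) ∧ ∃ α : C(I, X), ∀ t, α t = r (γ t)
    · obtain ⟨hp, α, hα⟩ := h
      rw [χp γ hp α hα]
      obtain ⟨β, rfl, hβ⟩ := A.exists_lift_of_mem_cells γ hγ
      rw [hu β (fun t => A.char_mem_punctured.1 (hp t)) α fun t => (hα t).trans (hrc _)]
      simp [hv, hβ]
    · simp only [χ, dif_neg h]
  have hχ : ∀ b, IsHolonomyOn (A.cover b) χ := by
    rintro (_ | _) ξ hξ
    · rw [χc _ fun t => hξ _, χc _ fun t => hξ _, χc _ fun t => hξ _]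
      simp [squareBottom, squareRight, squareDiag]
    · let ζ : C(I × I, X) := ⟨fun x => r (ξ x), hr.comp_continuous ξ.continuous hξ⟩
      rw [χp _ (fun t => hξ _) (ζ.comp squareBottom) fun t => rfl,
        χp _ (fun t => hξ _) (ζ.comp squareRight) fun t => rfl,
        χp _ (fun t => hξ _) (ζ.comp squareDiag) fun t => rfl]
      exact hφ ζ fun _ => mem_univ _
  obtain ⟨ψ, hψ, hψχ⟩ := exists_isHolonomy_of_cover A.cover A.isOpen_cover A.exists_mem_cover hχ
  refine ⟨ψ, hψ, fun α => ?_, fun β => ?_⟩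
  · have hα : ∀ t, A.incl.comp α t ∈ A.punctured := fun t => A.incl_mem_punctured _
    rw [hψχ true _ hα, χp _ hα α fun t => (hri _).symm]
  · have hcob : IsHolonomy fun β : C(I, K) => (u (β 0))⁻¹ * u (β 1) := fun ξ _ => by
      simp [squareBottom, squareRight, squareDiag]
    refine congrFun (IsHolonomy.ext_of_cover (fun b => A.char ⁻¹' A.cover b)
      (fun b => (A.isOpen_cover b).preimage A.char.continuous)
      (fun k => A.exists_mem_cover _) (hψ.comp A.char) hcob ?_) β
    rintro (_ | _) β hβ
    · rw [hψχ false _ hβ, χc _ hβ]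
      have hβ' : ∀ t, β t ∉ A.bdry := fun t => A.char_mem_cells.1 (hβ t)
      simp [hv, hβ']
    · have hβ' : ∀ t, β t ∉ A.center := fun t => A.char_mem_punctured.1 (hβ t)
      let α : C(I, X) := ⟨fun t => A.retr (β t),
        A.continuousOn_retr.comp_continuous β.continuous hβ'⟩
      rw [hψχ true _ hβ, χp _ hβ α fun t => (hrc _).symm]
      exact hu β hβ' α fun t => rfl

/-- Two holonomies on `Y` that agree on `X` and are related by a gauge transformation on the
cells are related by a gauge transformation. -/
theorem exists_gauge {φ ψ : C(I, Y) → G} (hφ : IsHolonomy φ) (hψ : IsHolonomy ψ)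
    (h : ∀ α : C(I, X), ψ (A.incl.comp α) = φ (A.incl.comp α)) (κ : K → G)
    (hκ : ∀ k ∈ A.bdry, κ k = 1)
    (hκφ : ∀ β : C(I, K), ψ (A.char.comp β) = κ (β 0) * φ (A.char.comp β) * (κ (β 1))⁻¹) :
    ∃ θ : Y → G, (∀ x, θ (A.incl x) = 1) ∧ ψ = gaugeHol θ φ := by
  classical
  obtain ⟨θ, hθi, hθc⟩ := A.exists_glue (fun _ => (1 : G)) κ hκ
  obtain ⟨r, hri, hrc⟩ := A.exists_glue id A.retr fun _ _ => rfl
  have hr : ContinuousOn r A.punctured := A.continuousOn_punctured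
    (by simpa [hri] using continuous_id') (by simpa [hrc] using A.continuousOn_retr)
  have hD : ∀ k ∉ A.center, Continuous fun t => A.deform (k, t) := fun k hk =>
    A.continuousOn_deform.comp_continuous (by fun_prop) fun t => ⟨hk, mem_univ _⟩
  let d : K → C(I, K) := fun k =>
    if hk : k ∈ A.center then ContinuousMap.const I k else ⟨fun t => A.deform (k, t), hD k hk⟩
  -- `D y` is the track of `y` under the deformation to `X`; the constant path at a center is a
  -- default value.
  obtain ⟨D, hDi, hDc⟩ := A.exists_glue (fun x => ContinuousMap.const I (A.incl x))
    (fun k => A.char.comp (d k)) fun k hk => by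
      ext t
      simp [d, A.notMem_center k hk, A.deform_bdry k hk, A.char_eq k hk]
  have hDcont : ContinuousOn D A.punctured := by
    refine A.continuousOn_punctured ?_ ?_
    · simp only [hDi]
      exact ContinuousMap.continuous_const'.comp A.incl.continuous
    · simp only [hDc]
      rw [continuousOn_iff_continuous_domRestrict]
      let e : C((A.centerᶜ : Set K) × I, Y) := ⟨fun p => A.char (A.deform (p.1, p.2)),
        A.char.continuous.comp (A.continuousOn_deform.comp_continuous (by fun_prop)
          fun p => ⟨p.1.2, mem_univ _⟩)⟩
      convert e.curry.continuous using 1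
      funext k
      ext t
      have hk : (k : K) ∉ A.center := k.2
      simp [d, e, hk]
  have hD0 : ∀ y ∈ A.punctured, D y 0 = y := by
    intro y hy
    rcases A.exists_rep y with ⟨x, rfl⟩ | ⟨k, hk, rfl⟩
    · simp [hDi]
    · have hk' := A.char_mem_punctured.1 hy
      simp [hDc, d, hk', A.deform_zero]
  have hD1 : ∀ y ∈ A.punctured, D y 1 = A.incl (r y) := by
    intro y hy
    rcases A.exists_rep y with ⟨x, rfl⟩ | ⟨k, hk, rfl⟩
    · simp [hDi, hri]
    · have hk' := A.char_mem_punctured.1 hy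
      simp [hDc, d, hk', A.deform_one, hrc]
  have hDgauge : ∀ y, ψ (D y) = θ (D y 0) * φ (D y) * (θ (D y 1))⁻¹ := by
    intro y
    rcases A.exists_rep y with ⟨x, rfl⟩ | ⟨k, hk, rfl⟩
    · simp [hDi, hφ.const, hψ.const]
    · rw [hDc, hκφ]
      simp [hθc]
  -- The square of tracks `D (γ t)` has `γ` at the bottom and its retraction to `X` at the top. The
  -- retraction has equal `φ` and `ψ`, and on the tracks the two differ by `θ`.
  have hfac : ∀ γ : C(I, Y), ∀ hγ : ∀ t, γ t ∈ A.punctured, ∀ χ : C(I, Y) → G, IsHolonomy χ →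
      χ γ = χ (D (γ 0)) * χ (A.incl.comp ⟨fun t => r (γ t), hr.comp_continuous γ.continuous hγ⟩) *
        (χ (D (γ 1)))⁻¹ := by
    intro γ hγ χ hχ
    let e : C(I, C(I, Y)) := ⟨fun t => D (γ t), hDcont.comp_continuous γ.continuous hγ⟩
    have := hχ.square e.uncurry
    rw [eq_mul_inv_iff_mul_eq]
    rw [show e.uncurry.comp ((ContinuousMap.id I).prodMk (ContinuousMap.const I 0)) = γ by
        ext t; exact hD0 _ (hγ t),
      show e.uncurry.comp ((ContinuousMap.id I).prodMk (ContinuousMap.const I 1)) = A.incl.comp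
        ⟨fun t => r (γ t), hr.comp_continuous γ.continuous hγ⟩ by
        ext t; exact hD1 _ (hγ t)] at this
    exact this
  refine ⟨θ, hθi, hψ.ext_of_cover A.cover A.isOpen_cover A.exists_mem_cover (hφ.gauge θ) ?_⟩
  rintro (_ | _) γ hγ
  · obtain ⟨β, rfl, -⟩ := A.exists_lift_of_mem_cells γ hγ
    rw [hκφ]
    simp [gaugeHol, hθc]
  · have hγ' : ∀ t, γ t ∈ A.punctured := hγ
    simp only [gaugeHol]
    rw [hfac γ hγ ψ hψ, hfac γ hγ φ hφ, h, hDgauge, hDgauge, hD0 _ (hγ' 0), hD0 _ (hγ' 1),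
      hD1 _ (hγ' 0), hD1 _ (hγ' 1), hθi, hθi]
    group

end CellAttachment

/-! ### Cells of a two-dimensional complex -/

section Sigma

variable {E D T : Type*} [TopologicalSpace D] [TopologicalSpace T]

theorem continuousOn_snd_preimage {O : Set D} (hO : IsOpen O) {g : (Σ _ : E, D) → T}
    (h : ∀ e, ContinuousOn (fun d => g ⟨e, d⟩) O) : ContinuousOn g (Sigma.snd ⁻¹' O) := by
  rintro ⟨e, d⟩ hd
  refine ContinuousAt.continuousWithinAt ?_
  have he : IsOpenEmbedding fun d : D => (⟨e, d⟩ : Σ _ : E, D) :=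
    @IsOpenEmbedding.sigmaMk E (fun _ => D) _ e
  refine he.continuousAt_iff.1 ((h e).continuousAt (hO.mem_nhds hd))

theorem continuousOn_sigma_deform {O : Set D} (hO : IsOpen O) {f : D × I → D}
    (hf : ContinuousOn f (O ×ˢ univ)) :
    ContinuousOn (fun p : (Σ _ : E, D) × I => (⟨p.1.1, f (p.1.2, p.2)⟩ : Σ _ : E, D))
      ((Sigma.snd ⁻¹' O) ×ˢ univ) := by
  rintro ⟨⟨e, d⟩, t⟩ hd
  refine ContinuousAt.continuousWithinAt ?_
  have he : IsOpenEmbedding fun d : D => (⟨e, d⟩ : Σ _ : E, D) :=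
    @IsOpenEmbedding.sigmaMk E (fun _ => D) _ e
  refine ((he.prodMap (IsOpenEmbedding.id (X := I))).continuousAt_iff (x := (d, t))).1 ?_
  exact he.continuous.continuousAt.comp
    (hf.continuousAt ((hO.prod isOpen_univ).mem_nhds ⟨hd.1, mem_univ _⟩))

/-- The inclusion of a single cell. -/
def cellMk (e : E) : C(D, Σ _ : E, D) := ⟨fun d => ⟨e, d⟩, @continuous_sigmaMk E (fun _ => D) _ e⟩

@[simp] theorem cellMk_apply (e : E) (d : D) : cellMk e d = ⟨e, d⟩ := rfl

theorem exists_eq_cellMk_comp (β : C(I, Σ _ : E, D)) : ∃ e, ∃ γ : C(I, D),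
    β = (cellMk e).comp γ := by
  obtain ⟨e, γ, h⟩ := β.exists_lift_sigma
  exact ⟨e, γ, h⟩

end Sigma

instance (V : Type*) : DiscreteTopology (ZeroSkeleton V) := ⟨rfl⟩

theorem eq_of_continuous_discrete {T : Type*} [TopologicalSpace T] [DiscreteTopology T]
    {f : I → T} (hf : Continuous f) (s t : I) : f s = f t :=
  PreconnectedSpace.constant inferInstance hf

theorem continuousOn_ite_half {T : Type*} [TopologicalSpace T] {O : Set I} {X : Type*}
    [TopologicalSpace X] {f g : I × X → T} (hf : Continuous f) (hg : Continuous g)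
    (hO : ∀ s ∈ O, (s : ℝ) ≠ 1 / 2) :
    ContinuousOn (fun p : I × X => if (p.1 : ℝ) < 1 / 2 then f p else g p) (O ×ˢ univ) := by
  rintro ⟨s, x⟩ hs
  refine ContinuousAt.continuousWithinAt ?_
  rcases (hO s hs.1).lt_or_gt with h | h
  · refine hf.continuousAt.congr ?_
    have : ∀ᶠ p : I × X in 𝓝 (s, x), (p.1 : ℝ) < 1 / 2 :=
      (isOpen_lt (by fun_prop) continuous_const).mem_nhds h
    filter_upwards [this] with p hp
    rw [if_pos hp]
  · refine hg.continuousAt.congr ?_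
    have : ∀ᶠ p : I × X in 𝓝 (s, x), 1 / 2 < (p.1 : ℝ) :=
      (isOpen_lt continuous_const (by fun_prop)).mem_nhds h
    filter_upwards [this] with p hp
    rw [if_neg hp.le.not_gt]

theorem continuousOn_ite_half' {T : Type*} [TopologicalSpace T] (a b : T) :
    ContinuousOn (fun s : I => if (s : ℝ) < 1 / 2 then a else b) {s : I | (s : ℝ) ≠ 1 / 2} := by
  have := continuousOn_ite_half (X := Unit) (T := T) (f := fun _ => a) (g := fun _ => b)
    (O := {s : I | (s : ℝ) ≠ 1 / 2}) continuous_const continuous_const fun s hs => hs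
  exact this.comp (f := fun s : I => (s, ())) (by fun_prop) fun s hs => ⟨hs, mem_univ _⟩

theorem isOpen_ne_half : IsOpen {s : I | (s : ℝ) ≠ 1 / 2} :=
  isOpen_ne_fun (by fun_prop) continuous_const

/-! ### Attaching the edges to the vertices -/

namespace OneComplex

variable {V E G : Type*} [Group G] (S : OneComplex V E)

open Classical in
/-- The normal form of a point of the disjoint union of vertices and edges. -/
def normalForm : ZeroSkeleton V ⊕ (Σ _ : E, I) → ZeroSkeleton V ⊕ (Σ _ : E, I)
  | .inl v => .inl v
  | .inr k => if k.2 = 0 then .inl (S.src k.1) else if k.2 = 1 then .inl (S.tgt k.1) else .inr k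

/-- The normal form respects the gluing relation, so it descends to the quotient and separates its
points without a description of the generated equivalence relation. -/
theorem normalForm_eq {a b : ZeroSkeleton V ⊕ (Σ _ : E, I)}
    (h : Quot.mk S.Glue a = Quot.mk S.Glue b) : S.normalForm a = S.normalForm b := by
  have hg : ∀ a b, S.Glue a b → S.normalForm a = S.normalForm b := by
    rintro _ _ (e | e) <;> simp [normalForm]
  exact congrArg (Quot.lift S.normalForm hg) h

theorem normalForm_inr {k : Σ _ : E, I} (hk : ¬(k.2 = 0 ∨ k.2 = 1)) :
    S.normalForm (.inr k) = .inr k := by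
  rw [not_or] at hk
  simp [normalForm, hk.1, hk.2]

/-- The deformation of the punctured interval to its end points. -/
def intervalDeform (p : I × I) : I :=
  if (p.1 : ℝ) < 1 / 2 then unitInterval.symm p.2 * p.1
    else unitInterval.symm (unitInterval.symm p.2 * unitInterval.symm p.1)

/-- A point of an edge as a point of the `1`-skeleton. -/
def edgePoint (k : Σ _ : E, I) : S.Space := Quot.mk _ (.inr k)

theorem edgePoint_zero (e : E) : S.edgePoint ⟨e, 0⟩ = S.vertex (S.src e) :=
  Quot.sound (Glue.src e)

theorem edgePoint_one (e : E) : S.edgePoint ⟨e, 1⟩ = S.vertex (S.tgt e) :=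
  Quot.sound (Glue.tgt e)

theorem vertex_injective : Function.Injective S.vertex := fun v w h => by
  have := S.normalForm_eq h
  exact Sum.inl.inj (β := Σ _ : E, I) this

/-- The end point of an edge that is nearest to a given point of the edge. -/
def nearestVertex (k : Σ _ : E, I) : V := if (k.2 : ℝ) < 1 / 2 then S.src k.1 else S.tgt k.1

/-- The `1`-skeleton is obtained from the vertices by attaching the edges. -/
def cellAttachment : CellAttachment (ZeroSkeleton V) (Σ _ : E, I) S.Space where
  incl := ⟨S.vertex, continuous_quot_mk.comp continuous_inl⟩
  char := ⟨S.edgePoint, continuous_quot_mk.comp continuous_inr⟩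
  isQuotientMap := by
    have h : IsQuotientMap (Quot.mk S.Glue) := isQuotientMap_quot_mk
    have hf : Quot.mk S.Glue =
      Sum.elim (fun v => Quot.mk S.Glue (.inl v)) (fun k => Quot.mk S.Glue (.inr k)) := by
      funext z; cases z <;> rfl
    rw [hf] at h
    exact h
  incl_injective := S.vertex_injective
  bdry := {k | k.2 = 0 ∨ k.2 = 1}
  center := {k | (k.2 : ℝ) = 1 / 2}
  isClosed_bdry := by
    have h : Continuous (Sigma.snd : (Σ _ : E, I) → I) := continuous_sigma fun _ => continuous_id
    exact (isClosed_eq h continuous_const).union (isClosed_eq h continuous_const)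
  isClosed_center := by
    have h : Continuous (Sigma.snd : (Σ _ : E, I) → I) := continuous_sigma fun _ => continuous_id
    exact isClosed_eq (continuous_subtype_val.comp h) continuous_const
  notMem_center := by
    rintro ⟨e, s⟩ (h | h) <;> dsimp only at h <;> subst h <;> norm_num
  retr := S.nearestVertex
  continuousOn_retr := continuousOn_snd_preimage isOpen_ne_half fun e =>
    continuousOn_ite_half' (T := ZeroSkeleton V) (S.src e) (S.tgt e)
  char_eq := by
    rintro ⟨e, s⟩ (h | h) <;> dsimp only at h <;> subst h
    · have : S.nearestVertex ⟨e, 0⟩ = S.src e := if_pos (by norm_num)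
      rw [this]
      exact S.edgePoint_zero e
    · have : S.nearestVertex ⟨e, 1⟩ = S.tgt e := if_neg (by norm_num)
      rw [this]
      exact S.edgePoint_one e
  char_inj k hk k' hk' h := by
    have := S.normalForm_eq h
    rwa [S.normalForm_inr hk, S.normalForm_inr hk', Sum.inr.injEq] at this
  char_ne k hk x h := by
    have := S.normalForm_eq h
    rw [S.normalForm_inr hk] at this
    cases this
  deform p := ⟨p.1.1, intervalDeform (p.1.2, p.2)⟩
  continuousOn_deform := continuousOn_sigma_deform isOpen_ne_half
    (continuousOn_ite_half (X := I) (by fun_prop) (by fun_prop) fun s hs => hs)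
  deform_zero := by
    rintro ⟨e, s⟩ _
    simp only [intervalDeform]
    split_ifs <;> simp
  deform_one := by
    rintro ⟨e, s⟩ _
    by_cases h : (s : ℝ) < 1 / 2
    · have h1 : S.nearestVertex ⟨e, s⟩ = S.src e := if_pos h
      have h2 : intervalDeform (s, 1) = 0 := by rw [intervalDeform, if_pos h]; simp
      rw [h1, h2]
      exact S.edgePoint_zero e
    · have h1 : S.nearestVertex ⟨e, s⟩ = S.tgt e := if_neg h
      have h2 : intervalDeform (s, 1) = 1 := by rw [intervalDeform, if_neg h]; simp
      rw [h1, h2]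
      exact S.edgePoint_one e
  deform_bdry := by
    rintro ⟨e, s⟩ (h | h) t <;> dsimp only at h <;> subst h <;> norm_num [intervalDeform]

/-- An edge as an unbundled path. -/
def edgeMap (e : E) : C(I, S.Space) := (S.edgePath e).toContinuousMap

theorem edgeMap_eq (e : E) : S.edgeMap e = S.cellAttachment.char.comp (cellMk e) := rfl

/-- Every labelling of the edges is the restriction of a holonomy on the `1`-skeleton. -/
theorem exists_isHolonomy (g : E → G) :
    ∃ φ : C(I, S.Space) → G, IsHolonomy φ ∧ ∀ e, φ (S.edgeMap e) = g e := by
  -- `u` jumps from `1` to `g e` at the midpoint of `e`. It is locally constant off the centers,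
  -- matching the trivial holonomy on vertices, and its coboundary on the full edge is `g e`.
  let u : (Σ _ : E, I) → G := fun k => if (k.2 : ℝ) < 1 / 2 then 1 else g k.1
  obtain ⟨φ, hφ, -, h⟩ := S.cellAttachment.exists_isHolonomy (isHolonomy_one (G := G)) u
    (by
      intro β hβ _ _
      let _ : TopologicalSpace G := ⊥
      have _ : DiscreteTopology G := ⟨rfl⟩
      have hu : ContinuousOn u (Sigma.snd ⁻¹' {s : I | (s : ℝ) ≠ 1 / 2}) :=
        continuousOn_snd_preimage isOpen_ne_half fun e => continuousOn_ite_half' 1 (g e)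
      have := eq_of_continuous_discrete (hu.comp_continuous β.continuous hβ) 0 1
      exact (inv_mul_eq_one.2 this).symm)
  refine ⟨φ, hφ, fun e => ?_⟩
  rw [edgeMap_eq, h]
  norm_num [u]

/-- The contraction of the interval to its origin. -/
def intervalContraction : C(I × I, I) := ⟨fun p => p.2 * p.1, by fun_prop⟩

/-- Two holonomies on the `1`-skeleton that agree on the edges differ by a gauge
transformation. -/
theorem exists_gauge {φ ψ : C(I, S.Space) → G} (hφ : IsHolonomy φ) (hψ : IsHolonomy ψ)
    (h : ∀ e, ψ (S.edgeMap e) = φ (S.edgeMap e)) :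
    ∃ θ : S.Space → G, (∀ v, θ (S.vertex v) = 1) ∧ ψ = gaugeHol θ φ := by
  let seg : (Σ _ : E, I) → C(I, S.Space) := fun k => (S.cellAttachment.char.comp (cellMk k.1)).comp
    (intervalContraction.comp ((ContinuousMap.const I k.2).prodMk (ContinuousMap.id I)))
  have hcob : ∀ χ : C(I, S.Space) → G, IsHolonomy χ → ∀ e (γ : C(I, I)),
      χ (S.cellAttachment.char.comp ((cellMk e).comp γ)) =
        (χ (seg ⟨e, γ 0⟩))⁻¹ * χ (seg ⟨e, γ 1⟩) := by
    intro χ hχ e γ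
    exact (hχ.comp (S.cellAttachment.char.comp (cellMk e))).eq_coboundary intervalContraction 0
      (fun x => zero_mul x) (fun x => one_mul x) γ
  -- On an edge both holonomies are coboundaries of their values on segments from the origin, and
  -- the gauge is the quotient. It is `1` at the origin trivially and at the far end by `h`.
  refine S.cellAttachment.exists_gauge hφ hψ ?_ (fun k => (ψ (seg k))⁻¹ * φ (seg k)) ?_ ?_
  · intro α
    have : α = ContinuousMap.const I (α 0) := by
      ext t; exact eq_of_continuous_discrete α.continuous t 0
    rw [this, ContinuousMap.comp_const, hψ.const, hφ.const]
  · rintro ⟨e, s⟩ (hs | hs) <;> dsimp only at hs <;> subst hs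
    · have : seg ⟨e, 0⟩ = ContinuousMap.const I (S.cellAttachment.char ⟨e, 0⟩) := by
        ext t; simp [seg, intervalContraction]
      rw [this, hψ.const, hφ.const, inv_mul_cancel]
    · have : seg ⟨e, 1⟩ = S.edgeMap e := by
        rw [edgeMap_eq]
        ext t; simp [seg, intervalContraction]
      rw [this, h, inv_mul_cancel]
  · intro β
    obtain ⟨e, γ, rfl⟩ := exists_eq_cellMk_comp β
    rw [hcob φ hφ, hcob ψ hψ]
    simp [mul_assoc]

end OneComplex

/-! ### Holonomies on the circle -/

/-- The standard loop that runs once around the circle. -/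
def circleLoop : C(I, Circle) := ⟨fun t => Circle.exp (2 * Real.pi * (t : ℝ)), by fun_prop⟩

/-- The arc of a given angle that starts at `1`. -/
def circleArc (x : ℝ) : C(I, Circle) := ⟨fun t => Circle.exp ((t : ℝ) * x), by fun_prop⟩

/-- A holonomy on the circle that is trivial on the standard loop is a coboundary. -/
theorem IsHolonomy.exists_circle_coboundary {G : Type*} [Group G] {φ : C(I, Circle) → G}
    (hφ : IsHolonomy φ) (h : φ circleLoop = 1) :
    ∃ u : Circle → G, ∀ β, φ β = (u (β 0))⁻¹ * u (β 1) := by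
  let e : C(ℝ, Circle) := Circle.exp
  have arc : ∀ x y, φ (circleArc y) = φ (circleArc x) * φ (e.comp (segPath x y)) := by
    intro x y
    have : ∀ z, circleArc z = e.comp (segPath 0 z) := fun z => by
      ext t; simp [circleArc, e]
    rw [this, this, hφ.triangle e 0 x y]
  have hloop : φ (circleArc (2 * Real.pi)) = 1 := by
    rw [← h]
    congr 1
    ext t
    simp [circleArc, circleLoop, mul_comm]
  have hper : Function.Periodic (fun x => φ (circleArc x)) (2 * Real.pi) := by
    intro x
    dsimp only
    rw [arc (2 * Real.pi) (x + 2 * Real.pi), hloop, one_mul]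
    congr 1
    ext t
    simp only [e, ContinuousMap.comp_apply, segPath_apply, circleArc, ContinuousMap.coe_mk,
      smul_eq_mul, add_sub_cancel_right]
    rw [Circle.exp_add, Circle.exp_two_pi, one_mul]
  -- By periodicity the holonomy of an arc depends only on its end point, so the jump of `arg` is
  -- harmless.
  refine ⟨fun z => φ (circleArc (Complex.arg z)), fun β => ?_⟩
  have hu : ∀ x, φ (circleArc (Complex.arg (Circle.exp x))) = φ (circleArc x) := by
    intro x
    obtain ⟨m, hm⟩ := Circle.exp_eq_exp.1 (Circle.exp_arg (Circle.exp x))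
    rw [hm]
    exact (hper.int_mul m x)
  -- Lift to the line, which contracts to `0`; the contraction tracks map to arcs starting at `1`.
  obtain ⟨Γ, hΓ, -⟩ := Circle.isCoveringMap_exp.exists_path_lifts β (Complex.arg (β 0))
    (Circle.exp_arg _).symm
  have hβ : ∀ t, β t = Circle.exp (Γ t) := fun t => (congrFun hΓ t).symm
  rw [hβ 0, hβ 1]
  dsimp only
  rw [hu, hu]
  have hc : IsHolonomy fun γ : C(I, ℝ) => φ (e.comp γ) := hφ.comp e
  have := hc.eq_coboundary ⟨fun p : ℝ × I => (p.2 : ℝ) * p.1, by fun_prop⟩ 0 (by simp) (by simp) Γ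
  have hβ' : β = e.comp Γ := by ext t; rw [hβ t]; rfl
  rw [hβ', this]
  rfl

/-! ### Attaching the faces -/

/-- The radial projection of the punctured plane to the circle. -/
def radialCircle (z : ℂ) : Circle :=
  if h : z = 0 then 1 else ⟨z / ‖z‖, by simp [Submonoid.unitSphere, h]⟩

theorem coe_radialCircle {z : ℂ} (h : z ≠ 0) : (radialCircle z : ℂ) = z / ‖z‖ := by
  simp [radialCircle, h]

theorem continuousOn_radialCircle : ContinuousOn radialCircle {z | z ≠ 0} := by
  have hemb : IsEmbedding ((↑) : Circle → ℂ) := IsEmbedding.subtypeVal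
  refine hemb.continuousOn_iff.2 ?_
  have : ContinuousOn (fun z : ℂ => z / ‖z‖) {z | z ≠ 0} :=
    continuousOn_id.div (by fun_prop) fun z hz => by simpa using hz
  exact this.congr fun z hz => coe_radialCircle hz

theorem radialCircle_coe (z : Circle) : radialCircle z = z := by
  ext; rw [coe_radialCircle (Circle.coe_ne_zero z)]; simp [Circle.norm_coe]

namespace TwoComplex

variable {V E F G : Type*} [Group G] (S : TwoComplex V E F)

open Classical in
/-- The normal form of a point of the disjoint union of the `1`-skeleton and the faces. -/
def normalForm : S.toOneComplex.Space ⊕ (Σ _ : F, Disk) → S.toOneComplex.Space ⊕ (Σ _ : F, Disk)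
  | .inl x => .inl x
  | .inr k => if ‖(k.2 : ℂ)‖ = 1 then .inl (S.attach k.1 (radialCircle k.2)) else .inr k

theorem normalForm_eq {a b : S.toOneComplex.Space ⊕ (Σ _ : F, Disk)}
    (h : Quot.mk S.Glue a = Quot.mk S.Glue b) : S.normalForm a = S.normalForm b := by
  have hg : ∀ a b, S.Glue a b → S.normalForm a = S.normalForm b := by
    rintro _ _ ⟨p, z⟩
    simp [normalForm, boundaryPoint, radialCircle_coe, Circle.norm_coe]
  exact congrArg (Quot.lift S.normalForm hg) h

theorem normalForm_inr {k : Σ _ : F, Disk} (hk : ‖(k.2 : ℂ)‖ ≠ 1) :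
    S.normalForm (.inr k) = .inr k := by
  simp [normalForm, hk]

theorem radialCircle_mem_disk (z : ℂ) : (radialCircle z : ℂ) ∈ Metric.closedBall (0 : ℂ) 1 := by
  simp [Circle.norm_coe]

/-- The radial deformation of the punctured disk to the circle. -/
def diskDeform (p : Disk × I) : Disk :=
  ⟨p.1 + (p.2 : ℝ) • (radialCircle p.1 - p.1 : ℂ),
    (convex_closedBall (0 : ℂ) 1).add_smul_sub_mem p.1.2 (radialCircle_mem_disk _) p.2.2⟩

theorem diskDeform_one (z : Disk) : diskDeform (z, 1) = boundaryPoint (radialCircle z) := by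
  ext; simp [diskDeform, boundaryPoint]

theorem isOpen_disk_ne_zero : IsOpen {z : Disk | (z : ℂ) ≠ 0} :=
  isOpen_ne_fun (by fun_prop) continuous_const

theorem continuousOn_diskDeform : ContinuousOn diskDeform ({z : Disk | (z : ℂ) ≠ 0} ×ˢ univ) := by
  rw [IsEmbedding.subtypeVal.continuousOn_iff]
  have h : ContinuousOn (fun p : Disk × I => (radialCircle p.1 : ℂ))
      ({z : Disk | (z : ℂ) ≠ 0} ×ˢ univ) :=
    continuous_subtype_val.comp_continuousOn
      (continuousOn_radialCircle.comp (by fun_prop) fun p hp => hp.1)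
  have h1 : Continuous fun p : Disk × I => (p.1 : ℂ) := by fun_prop
  have h2 : Continuous fun p : Disk × I => (p.2 : ℝ) := by fun_prop
  exact h1.continuousOn.add (h2.continuousOn.smul (h.sub h1.continuousOn))

/-- A point of the `1`-skeleton as a point of the complex. -/
def skeletonPoint (x : S.toOneComplex.Space) : S.Space := Quot.mk _ (.inl x)

/-- A point of a closed face as a point of the complex. -/
def facePoint (k : Σ _ : F, Disk) : S.Space := Quot.mk _ (.inr k)

theorem facePoint_boundary (p : F) (z : Circle) :
    S.facePoint ⟨p, boundaryPoint z⟩ = S.skeletonPoint (S.attach p z) :=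
  Quot.sound (Glue.boundary p z)

theorem boundaryPoint_radialCircle {z : Disk} (h : ‖(z : ℂ)‖ = 1) :
    boundaryPoint (radialCircle z) = z := by
  ext
  change (radialCircle z : ℂ) = z
  rw [coe_radialCircle (by rintro h'; simp [h'] at h), h]
  simp

theorem skeletonPoint_injective : Function.Injective S.skeletonPoint := fun v w h => by
  have := S.normalForm_eq h
  simpa only [normalForm, Sum.inl.injEq] using this

/-- A two-dimensional complex is obtained from its `1`-skeleton by attaching the faces. -/
def cellAttachment : CellAttachment S.toOneComplex.Space (Σ _ : F, Disk) S.Space where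
  incl := ⟨S.skeletonPoint, continuous_quot_mk.comp continuous_inl⟩
  char := ⟨S.facePoint, continuous_quot_mk.comp continuous_inr⟩
  isQuotientMap := by
    have h : IsQuotientMap (Quot.mk S.Glue) := isQuotientMap_quot_mk
    have hf : Quot.mk S.Glue =
      Sum.elim (fun x => Quot.mk S.Glue (.inl x)) (fun k => Quot.mk S.Glue (.inr k)) := by
      funext z; cases z <;> rfl
    rw [hf] at h
    exact h
  incl_injective := S.skeletonPoint_injective
  bdry := {k | ‖(k.2 : ℂ)‖ = 1}
  center := {k | (k.2 : ℂ) = 0}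
  isClosed_bdry := by
    have h : Continuous (Sigma.snd : (Σ _ : F, Disk) → Disk) :=
      continuous_sigma fun _ => continuous_id
    exact isClosed_eq (continuous_norm.comp (continuous_subtype_val.comp h)) continuous_const
  isClosed_center := by
    have h : Continuous (Sigma.snd : (Σ _ : F, Disk) → Disk) :=
      continuous_sigma fun _ => continuous_id
    exact isClosed_eq (continuous_subtype_val.comp h) continuous_const
  notMem_center k hk hk' := by
    rw [mem_ofPred_eq] at hk hk'
    simp [hk'] at hk
  retr k := S.attach k.1 (radialCircle k.2)
  continuousOn_retr := continuousOn_snd_preimage isOpen_disk_ne_zero fun p =>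
    (S.attach p).continuous.comp_continuousOn
      (continuousOn_radialCircle.comp (by fun_prop) fun z hz => hz)
  char_eq := by
    rintro ⟨p, z⟩ h
    have := S.facePoint_boundary p (radialCircle z)
    rwa [boundaryPoint_radialCircle h] at this
  char_inj k hk k' hk' h := by
    have := S.normalForm_eq h
    rwa [S.normalForm_inr hk, S.normalForm_inr hk', Sum.inr.injEq] at this
  char_ne k hk x h := by
    have := S.normalForm_eq h
    rw [S.normalForm_inr hk] at this
    cases this
  deform p := ⟨p.1.1, diskDeform (p.1.2, p.2)⟩
  continuousOn_deform := continuousOn_sigma_deform isOpen_disk_ne_zero continuousOn_diskDeform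
  deform_zero := by
    rintro ⟨e, s⟩ _
    simp [diskDeform]
  deform_one := by
    rintro ⟨p, z⟩ _
    rw [diskDeform_one]
    exact S.facePoint_boundary p _
  deform_bdry := by
    rintro ⟨p, z⟩ h t
    have h' := congrArg Subtype.val (boundaryPoint_radialCircle h)
    change (radialCircle z : ℂ) = z at h'
    simp [diskDeform, h']

/-- The boundary circle as a continuous map to the disk. -/
def circleToDisk : C(Circle, Disk) :=
  ⟨boundaryPoint, by unfold boundaryPoint; fun_prop⟩

theorem char_comp_circle (p : F) : S.cellAttachment.char.comp ((cellMk p).comp circleToDisk) =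
    S.cellAttachment.incl.comp (S.attach p) := by
  ext z
  exact S.facePoint_boundary p z

/-- The contraction of the disk to the boundary point `1`. -/
def diskContraction : C(Disk × I, Disk) :=
  ⟨fun p => ⟨1 + (p.2 : ℝ) • ((p.1 : ℂ) - 1),
    (convex_closedBall (0 : ℂ) 1).add_smul_sub_mem (by simp) p.1.2 p.2.2⟩, by fun_prop⟩

/-- The straight path to a point of a face from the base point of its boundary. -/
def diskSeg (k : Σ _ : F, Disk) : C(I, S.Space) :=
  (S.cellAttachment.char.comp (cellMk k.1)).comp
    (diskContraction.comp ((ContinuousMap.const I k.2).prodMk (ContinuousMap.id I)))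

/-- The closed disk contracts to its boundary point `1`. -/
theorem hol_face {φ : C(I, S.Space) → G} (hφ : IsHolonomy φ) (p : F) (γ : C(I, Disk)) :
    φ (S.cellAttachment.char.comp ((cellMk p).comp γ)) =
      (φ (S.diskSeg ⟨p, γ 0⟩))⁻¹ * φ (S.diskSeg ⟨p, γ 1⟩) := by
  refine (hφ.comp (S.cellAttachment.char.comp (cellMk p))).eq_coboundary diskContraction
    (boundaryPoint 1) ?_ ?_ γ
  · intro x; ext; simp [diskContraction, boundaryPoint]
  · intro x; ext; simp [diskContraction]

/-- The attaching map extends over the disk. -/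
theorem hol_attach {φ : C(I, S.Space) → G} (hφ : IsHolonomy φ) (p : F) (γ : C(I, Circle)) :
    φ (S.cellAttachment.incl.comp ((S.attach p).comp γ)) =
      (φ (S.diskSeg ⟨p, boundaryPoint (γ 0)⟩))⁻¹ * φ (S.diskSeg ⟨p, boundaryPoint (γ 1)⟩) := by
  rw [← ContinuousMap.comp_assoc, ← char_comp_circle]
  exact S.hol_face hφ p (circleToDisk.comp γ)

/-- The attaching loops have trivial holonomy. -/
theorem hol_attachLoop {φ : C(I, S.Space) → G} (hφ : IsHolonomy φ) (p : F) :
    φ (S.cellAttachment.incl.comp (S.attachLoop p).toContinuousMap) = 1 := by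
  refine (S.hol_attach hφ p circleLoop).trans ?_
  simp [circleLoop]

/-- A holonomy on the `1`-skeleton that is trivial on the attaching loops extends to the
complex. -/
theorem exists_isHolonomy {φ : C(I, S.toOneComplex.Space) → G} (hφ : IsHolonomy φ)
    (h : ∀ p, φ (S.attachLoop p).toContinuousMap = 1) :
    ∃ ψ : C(I, S.Space) → G, IsHolonomy ψ ∧ ∀ α, ψ (S.cellAttachment.incl.comp α) = φ α := by
  have := fun p => (hφ.comp (S.attach p)).exists_circle_coboundary (h p)
  choose u hu using this
  -- Each circle coboundary is extended radially over the punctured disk; the value at the center is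
  -- arbitrary.
  obtain ⟨ψ, hψ, h1, -⟩ := S.cellAttachment.exists_isHolonomy hφ
    (fun k => u k.1 (radialCircle k.2)) (by
      intro β hβ α hα
      obtain ⟨p, γ, rfl⟩ := exists_eq_cellMk_comp β
      have hβ' : ∀ t, (γ t : ℂ) ≠ 0 := hβ
      let δ : C(I, Circle) := ⟨fun t => radialCircle (γ t),
        continuousOn_radialCircle.comp_continuous (by fun_prop) hβ'⟩
      have : α = (S.attach p).comp δ := ContinuousMap.ext hα
      rw [this]
      exact hu p δ)
  exact ⟨ψ, hψ, h1⟩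

/-- Two holonomies on a complex that agree on the `1`-skeleton differ by a gauge
transformation. -/
theorem exists_gauge {φ ψ : C(I, S.Space) → G} (hφ : IsHolonomy φ) (hψ : IsHolonomy ψ)
    (h : ∀ α, ψ (S.cellAttachment.incl.comp α) = φ (S.cellAttachment.incl.comp α)) :
    ∃ θ : S.Space → G, ψ = gaugeHol θ φ := by
  have hone : ∀ χ : C(I, S.Space) → G, IsHolonomy χ → ∀ p,
      χ (S.diskSeg ⟨p, boundaryPoint 1⟩) = 1 := by
    intro χ hχ p
    rw [show S.diskSeg ⟨p, boundaryPoint 1⟩ =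
      ContinuousMap.const I (S.cellAttachment.char ⟨p, boundaryPoint 1⟩) from ?_, hχ.const]
    ext t
    simp [diskSeg, diskContraction, boundaryPoint]
  have hseg : ∀ p (z : Circle), ψ (S.diskSeg ⟨p, boundaryPoint z⟩) =
      φ (S.diskSeg ⟨p, boundaryPoint z⟩) := by
    intro p z
    -- The segment to the boundary point `1` is constant, so the arc from `1` to `z`, which lies in
    -- the 1-skeleton, computes the value at `z`.
    have := h ((S.attach p).comp (circleArc (Complex.arg z)))
    rw [S.hol_attach hφ, S.hol_attach hψ] at this
    simpa [circleArc, hone φ hφ, hone ψ hψ, Circle.exp_arg] using this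
  obtain ⟨θ, -, hθ⟩ := S.cellAttachment.exists_gauge hφ hψ h
    (fun k => (ψ (S.diskSeg k))⁻¹ * φ (S.diskSeg k))
    (by
      rintro ⟨p, z⟩ hk
      have hz : boundaryPoint (radialCircle z) = z := boundaryPoint_radialCircle hk
      rw [← hz, hseg, inv_mul_cancel])
    (by
      intro β
      obtain ⟨p, γ, rfl⟩ := exists_eq_cellMk_comp β
      rw [S.hol_face hφ, S.hol_face hψ]
      simp [mul_assoc])
  exact ⟨θ, hθ⟩

end TwoComplex

/-! ### Holonomies and homomorphisms from the fundamental group -/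

/-- A continuous map from the interval as a path between its end points. -/
def pathOfMap {Y : Type*} [TopologicalSpace Y] (γ : C(I, Y)) : Path (γ 0) (γ 1) := ⟨γ, rfl, rfl⟩

/-- Here `b` and `b'` are the holonomies of one path, and the other letters those of the paths from
the base point to its ends; the formula reads off the gauge. -/
theorem eq_gauge_of_conj {G : Type*} [Group G] {a b c g a' b' c' : G}
    (h : (a * b * c⁻¹)⁻¹ = g * (a' * b' * c'⁻¹)⁻¹ * g⁻¹) :
    b = a⁻¹ * g * a' * b' * (c⁻¹ * g * c')⁻¹ := by
  have h' : a * b * c⁻¹ = g * (a' * b' * c'⁻¹) * g⁻¹ := by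
    rw [← inv_inv (a * b * c⁻¹), h]; group
  have h2 : b = a⁻¹ * (a * b * c⁻¹) * c := by group
  rw [h2, h']; group

namespace IsHolonomy

variable {Y G : Type*} [TopologicalSpace Y] [Group G] {φ : C(I, Y) → G} {x y z : Y}

theorem path_refl (hφ : IsHolonomy φ) (x : Y) : φ (Path.refl x).toContinuousMap = 1 := hφ.const x

/-- The triangle identity at `0`, `1 / 2`, `1` on the line: the halves of the concatenation are
linear reparametrizations. -/
theorem path_trans (hφ : IsHolonomy φ) (p : Path x y) (q : Path y z) :
    φ (p.trans q).toContinuousMap = φ p.toContinuousMap * φ q.toContinuousMap := by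
  have := hφ.triangle (extendPath (p.trans q).toContinuousMap) 0 (1 / 2) 1
  rw [extendPath_segPath] at this
  rw [← this]
  congr 2
  · ext t
    have ht : (t : ℝ) * (1 / 2) ∈ I := ⟨by linarith [t.2.1], by linarith [t.2.2]⟩
    change p.trans q (projIcc 0 1 zero_le_one (0 + (t : ℝ) * (1 / 2 - 0))) = p t
    rw [zero_add, sub_zero, projIcc_of_mem _ ht, Path.trans_apply, dif_pos (by
      change (t : ℝ) * (1 / 2) ≤ 1 / 2
      linarith [t.2.2])]
    congr 1
    ext
    change 2 * ((t : ℝ) * (1 / 2)) = t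
    ring
  · ext t
    have ht : 1 / 2 + (t : ℝ) * (1 - 1 / 2) ∈ I := ⟨by linarith [t.2.1], by linarith [t.2.2]⟩
    change p.trans q (projIcc 0 1 zero_le_one (1 / 2 + (t : ℝ) * (1 - 1 / 2))) = q t
    rw [projIcc_of_mem _ ht, Path.trans_apply]
    split_ifs with h
    · have h' : 1 / 2 + (t : ℝ) * (1 - 1 / 2) ≤ 1 / 2 := h
      have h0 : (t : ℝ) = 0 := by linarith [t.2.1]
      have : t = 0 := Subtype.ext h0
      subst this
      rw [q.source]
      convert p.target
      norm_num
    · congr 1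
      ext
      change 2 * (1 / 2 + (t : ℝ) * (1 - 1 / 2)) - 1 = t
      ring

/-- Two opposite sides of the homotopy square are constant. -/
theorem path_homotopic (hφ : IsHolonomy φ) {p q : Path x y} (h : p.Homotopic q) :
    φ p.toContinuousMap = φ q.toContinuousMap := by
  obtain ⟨F⟩ := h
  have := hφ.square F.toContinuousMap
  have e0 : F.toContinuousMap.comp ((ContinuousMap.id I).prodMk (ContinuousMap.const I 0)) =
      ContinuousMap.const I x := by ext t; exact F.source t
  have e1 : F.toContinuousMap.comp ((ContinuousMap.id I).prodMk (ContinuousMap.const I 1)) =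
      ContinuousMap.const I y := by ext t; exact F.target t
  have e2 : F.toContinuousMap.comp ((ContinuousMap.const I 0).prodMk (ContinuousMap.id I)) =
      p.toContinuousMap := by ext t; exact F.apply_zero t
  have e3 : F.toContinuousMap.comp ((ContinuousMap.const I 1).prodMk (ContinuousMap.id I)) =
      q.toContinuousMap := by ext t; exact F.apply_one t
  rw [e0, e1, e2, e3, hφ.const, hφ.const, one_mul, mul_one] at this
  exact this.symm

theorem path_symm (hφ : IsHolonomy φ) (p : Path x y) :
    φ p.symm.toContinuousMap = (φ p.toContinuousMap)⁻¹ := by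
  rw [eq_inv_iff_mul_eq_one, ← hφ.path_trans, ← hφ.path_refl y]
  exact hφ.path_homotopic (Path.Homotopic.symm_trans p)

/-- The homomorphism from the fundamental group that belongs to a holonomy. The inverse accounts
for the order of multiplication in the fundamental group. -/
def toHom (hφ : IsHolonomy φ) (x : Y) : FundamentalGroup Y x →* G where
  toFun := Quotient.lift (s := Path.Homotopic.setoid x x) (fun p => (φ p.toContinuousMap)⁻¹)
    fun _ _ h => congrArg _ (hφ.path_homotopic h)
  map_one' := by
    change (φ (Path.refl x).toContinuousMap)⁻¹ = 1
    rw [hφ.path_refl, inv_one]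
  map_mul' := by
    rintro ⟨p⟩ ⟨q⟩
    change (φ (q.trans p).toContinuousMap)⁻¹ = _
    rw [hφ.path_trans, mul_inv_rev]

theorem toHom_mk (hφ : IsHolonomy φ) (p : Path x x) :
    hφ.toHom x (Path.Homotopic.Quotient.mk p) = (φ p.toContinuousMap)⁻¹ := rfl

/-- Gauge equivalent holonomies define conjugate homomorphisms. -/
theorem toHom_gauge (hφ : IsHolonomy φ) {ψ : C(I, Y) → G} (hψ : IsHolonomy ψ) {κ : Y → G}
    (h : ψ = gaugeHol κ φ) (x : Y) : adSetoid (FundamentalGroup Y x) G (hφ.toHom x) (hψ.toHom x) := by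
  refine ⟨κ x, ?_⟩
  rintro ⟨p⟩
  change (ψ p.toContinuousMap)⁻¹ = κ x * (φ p.toContinuousMap)⁻¹ * (κ x)⁻¹
  subst h
  simp [gaugeHol, mul_assoc]

/-- On a path connected space, holonomies that define conjugate homomorphisms are gauge
equivalent. -/
theorem exists_gauge_of_toHom [PathConnectedSpace Y] (hφ : IsHolonomy φ) {ψ : C(I, Y) → G}
    (hψ : IsHolonomy ψ) (h : adSetoid (FundamentalGroup Y x) G (hφ.toHom x) (hψ.toHom x)) :
    ∃ κ : Y → G, ψ = gaugeHol κ φ := by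
  obtain ⟨g, hg⟩ := h
  let c : ∀ y, Path x y := fun y => PathConnectedSpace.somePath x y
  -- The conjugator `g` at `x` is transported to `y` along the chosen path `c y`.
  refine ⟨fun y => (ψ (c y).toContinuousMap)⁻¹ * g * φ (c y).toContinuousMap, ?_⟩
  funext γ
  have := hg (Path.Homotopic.Quotient.mk (((c _).trans (pathOfMap γ)).trans (c _).symm))
  rw [toHom_mk, toHom_mk] at this
  simp only [path_trans hφ, path_trans hψ, path_symm hφ, path_symm hψ] at this
  exact eq_gauge_of_conj this

end IsHolonomy

instance : ContractibleSpace I :=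
  (convex_Icc (0 : ℝ) 1).contractibleSpace ⟨0, by simp⟩

/-- Every homomorphism from the fundamental group of a path connected space is, up to
conjugation, the homomorphism of a holonomy. -/
theorem exists_isHolonomy_toHom {Y G : Type*} [TopologicalSpace Y] [Group G]
    [PathConnectedSpace Y] (x : Y) (θ : FundamentalGroup Y x →* G) :
    ∃ (φ : C(I, Y) → G) (hφ : IsHolonomy φ),
      adSetoid (FundamentalGroup Y x) G (hφ.toHom x) θ := by
  let c : ∀ y, Path.Homotopic.Quotient x y := fun y => .mk (PathConnectedSpace.somePath x y)
  let L : ∀ {y z : Y}, Path.Homotopic.Quotient y z → FundamentalGroup Y x :=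
    fun {y z} p => ((c y).trans p).trans (c z).symm
  have hL : ∀ {y z w : Y} (p : Path.Homotopic.Quotient y z) (q : Path.Homotopic.Quotient z w),
      L q * L p = L (p.trans q) := by
    intro y z w p q
    change (((c y).trans p).trans (c z).symm).trans (((c z).trans q).trans (c w).symm) =
      ((c y).trans (p.trans q)).trans (c w).symm
    simp only [Path.Homotopic.Quotient.trans_assoc]
    rw [← Path.Homotopic.Quotient.trans_assoc (c z).symm (c z),
      Path.Homotopic.Quotient.symm_trans, Path.Homotopic.Quotient.refl_trans]
  let φ : C(I, Y) → G := fun γ => (θ (L (.mk (pathOfMap γ))))⁻¹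
  have hφ : IsHolonomy φ := by
    intro ξ _
    let b : Path ((0, 0) : I × I) (1, 0) := ⟨squareBottom, rfl, rfl⟩
    let r : Path ((1, 0) : I × I) (1, 1) := ⟨squareRight, rfl, rfl⟩
    let d : Path ((0, 0) : I × I) (1, 1) := ⟨squareDiag, rfl, rfl⟩
    have hbr : (Path.Homotopic.Quotient.mk (b.map ξ.continuous)).trans
        (.mk (r.map ξ.continuous)) = .mk (d.map ξ.continuous) := by
      -- In the simply connected square, bottom followed by right side is homotopic to the diagonal.
      rw [← Path.Homotopic.Quotient.mk_trans, ← Path.map_trans, Path.Homotopic.Quotient.eq]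
      exact (SimplyConnectedSpace.paths_homotopic (b.trans r) d).map ξ
    change (θ (L (.mk (b.map ξ.continuous))))⁻¹ * (θ (L (.mk (r.map ξ.continuous))))⁻¹ =
      (θ (L (.mk (d.map ξ.continuous))))⁻¹
    rw [← mul_inv_rev, ← map_mul, hL, hbr]
  -- The chosen path from `x` to itself need not be trivial, whence the conjugation.
  refine ⟨φ, hφ, θ (c x), ?_⟩
  rintro ⟨p⟩
  change θ (Path.Homotopic.Quotient.mk p) =
    θ (c x) * ((θ (L (Path.Homotopic.Quotient.mk (pathOfMap p.toContinuousMap))))⁻¹)⁻¹ *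
      (θ (c x))⁻¹
  have hp : ∀ {y z : Y} (p : Path y z), L (.mk (pathOfMap p.toContinuousMap)) = L (.mk p) := by
    rintro y z ⟨γ, rfl, rfl⟩
    rfl
  let k : FundamentalGroup Y x := c x
  let s : FundamentalGroup Y x := Path.Homotopic.Quotient.mk p
  have hs : L (.mk p) = k⁻¹ * (s * k) := rfl
  rw [hp, hs, inv_inv]
  change θ s = θ k * θ (k⁻¹ * (s * k)) * (θ k)⁻¹
  simp only [map_mul, map_inv, mul_assoc, mul_inv_cancel, mul_one, mul_inv_cancel_left]

/-! ### Path connectedness -/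

/-- Local path connectedness upgrades connectedness of the complex to path connectedness. It passes
to coproducts and quotients; the interval and the disk are retracts of `ℝ` and `ℂ`. -/
instance : LocallyPathConnectedSpace I :=
  (IsQuotientMap.of_inverse (g := projIcc (0 : ℝ) 1 zero_le_one) (f := Subtype.val)
    continuous_subtype_val continuous_projIcc
    fun t => projIcc_val zero_le_one t).locallyPathConnectedSpace

/-- The radial retraction of the plane to the closed unit disk. -/
def diskRetraction (z : ℂ) : TwoComplex.Disk :=
  ⟨(max 1 ‖z‖)⁻¹ • z, by
    rw [mem_closedBall_zero_iff, norm_smul, norm_inv, Real.norm_of_nonneg (by positivity)]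
    exact inv_mul_le_one_of_le₀ (le_max_right _ _) (by positivity)⟩

instance : LocallyPathConnectedSpace TwoComplex.Disk := by
  have hc : Continuous diskRetraction := by
    have : ∀ z : ℂ, max 1 ‖z‖ ≠ 0 := fun z => by positivity
    unfold diskRetraction
    fun_prop (disch := exact this _)
  refine (IsQuotientMap.of_inverse (g := diskRetraction) (f := Subtype.val)
    continuous_subtype_val hc fun z => ?_).locallyPathConnectedSpace
  have hz : ‖(z : ℂ)‖ ≤ 1 := mem_closedBall_zero_iff.1 z.2
  ext
  simp [diskRetraction, max_eq_left hz]

instance (V : Type*) : LocallyPathConnectedSpace (ZeroSkeleton V) where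
  path_connected_basis x := by
    rw [nhds_discrete]
    refine Filter.hasBasis_self.2 fun t ht => ⟨{x}, Filter.mem_pure.2 rfl, ?_, ?_⟩
    · exact isPathConnected_singleton x
    · exact singleton_subset_iff.2 (Filter.mem_pure.1 ht)

instance {V E : Type*} (S : OneComplex V E) : LocallyPathConnectedSpace S.Space :=
  inferInstanceAs (LocallyPathConnectedSpace (Quot S.Glue))

instance {V E F : Type*} (S : TwoComplex V E F) : LocallyPathConnectedSpace S.Space :=
  inferInstanceAs (LocallyPathConnectedSpace (Quot S.Glue))

/-! ### Flat labellings and holonomies -/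

namespace OneComplex

variable {V E G : Type*} [Group G] (S : OneComplex V E)

/-- The action of a gauge transformation on a labelling of the edges. -/
def gaugeAct (k : V → G) (g : E → G) : E → G := fun q => k (S.src q) * g q * (k (S.tgt q))⁻¹

theorem gaugeAct_mul (k k' : V → G) (g : E → G) :
    S.gaugeAct (k * k') g = S.gaugeAct k (S.gaugeAct k' g) := by
  funext q; simp [gaugeAct, mul_assoc]

theorem gaugeAct_one (g : E → G) : S.gaugeAct 1 g = g := by
  funext q; simp [gaugeAct]

variable {S}

/-- The holonomy along an edge walk is the product of the labels of its letters. -/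
theorem hol_walk {φ : C(I, S.Space) → G} (hφ : IsHolonomy φ) {v w : V} (c : S.Walk v w) :
    φ c.path.toContinuousMap = groupWord (fun e => φ (S.edgeMap e)) c.letters := by
  induction c with
  | nil v => exact hφ.path_refl _
  | cons a rest ih =>
    have h1 : φ (S.signedEdgePath a).toContinuousMap =
        if a.2 then φ (S.edgeMap a.1) else (φ (S.edgeMap a.1))⁻¹ := by
      obtain ⟨e, _ | _⟩ := a
      · exact hφ.path_symm _
      · rfl
    refine (hφ.path_trans _ _).trans ?_
    rw [h1, ih]
    simp [groupWord, Walk.letters]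

/-- The gauge factors at interior vertices of the walk cancel in pairs. -/
theorem groupWord_gaugeAct (k : V → G) (g : E → G) {v w : V} (c : S.Walk v w) :
    groupWord (S.gaugeAct k g) c.letters = k v * groupWord g c.letters * (k w)⁻¹ := by
  induction c with
  | nil v => simp [groupWord, Walk.letters]
  | cons a rest ih =>
    simp only [groupWord, Walk.letters, List.map_cons, List.prod_cons] at ih ⊢
    rw [ih]
    obtain ⟨e, _ | _⟩ := a <;> simp [gaugeAct, origin, terminus, mul_assoc]

end OneComplex

namespace SmoothQDCode

variable {V E F G : Type*} [Group G] {S : TwoComplex V E F} (C : SmoothQDCode S)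

/-- A labelling of the edges is flat if it satisfies the constraints of all `Z`-checks. -/
def IsFlat (g : E → G) : Prop := ∀ p, groupWord g (C.boundary p).letters = 1

theorem isFlat_gaugeAct_iff (k : V → G) (g : E → G) : C.IsFlat (S.gaugeAct k g) ↔ C.IsFlat g := by
  simp only [IsFlat, OneComplex.groupWord_gaugeAct, conj_eq_one_iff]

/-- A free homotopy changes holonomy only by conjugation. -/
theorem hol_attachLoop_eq_one_iff {φ : C(I, S.toOneComplex.Space) → G} (hφ : IsHolonomy φ) (p : F) :
    φ (S.attachLoop p).toContinuousMap = 1 ↔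
      groupWord (fun e => φ (S.toOneComplex.edgeMap e)) (C.boundary p).letters = 1 := by
  obtain ⟨δ, hδ⟩ := C.attach_homotopic p
  rw [hφ.path_homotopic hδ, hφ.path_trans, hφ.path_trans, hφ.path_symm, OneComplex.hol_walk hφ,
    conj_eq_one_iff]

end SmoothQDCode

/-! ### From flat labellings to the fundamental group -/

namespace TwoComplex

variable {V E F G : Type*} [Group G] (S : TwoComplex V E F)

/-- The labelling of the edges by a function on paths. -/
def edgeLabels (φ : C(I, S.Space) → G) : E → G :=
  fun e => φ (S.cellAttachment.incl.comp (S.toOneComplex.edgeMap e))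

variable {S}

theorem isFlat_edgeLabels (C : SmoothQDCode S) {φ : C(I, S.Space) → G} (hφ : IsHolonomy φ) :
    C.IsFlat (S.edgeLabels φ) := fun p =>
  (C.hol_attachLoop_eq_one_iff (hφ.comp S.cellAttachment.incl) p).1 (S.hol_attachLoop hφ p)

/-- Every flat labelling comes from a holonomy. -/
theorem exists_edgeLabels_eq (C : SmoothQDCode S) {g : E → G} (hg : C.IsFlat g) :
    ∃ φ : C(I, S.Space) → G, IsHolonomy φ ∧ S.edgeLabels φ = g := by
  obtain ⟨φ, hφ, h⟩ := S.toOneComplex.exists_isHolonomy g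
  obtain ⟨ψ, hψ, h'⟩ := S.exists_isHolonomy hφ fun p =>
    (C.hol_attachLoop_eq_one_iff hφ p).2 (by simpa only [h] using hg p)
  exact ⟨ψ, hψ, funext fun e => (h' _).trans (h e)⟩

theorem edgeLabels_gauge (κ : S.Space → G) (φ : C(I, S.Space) → G) :
    S.edgeLabels (gaugeHol κ φ) = S.gaugeAct
      (fun v => κ (S.cellAttachment.incl (S.vertex v))) (S.edgeLabels φ) := by
  funext e
  have h0 : S.toOneComplex.edgeMap e 0 = S.vertex (S.src e) := (S.edgePath e).source
  have h1 : S.toOneComplex.edgeMap e 1 = S.vertex (S.tgt e) := (S.edgePath e).target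
  simp [edgeLabels, gaugeHol, OneComplex.gaugeAct, h0, h1]

/-- Holonomies with the same edge labels are gauge equivalent. -/
theorem exists_gauge_of_edgeLabels_eq {φ ψ : C(I, S.Space) → G} (hφ : IsHolonomy φ)
    (hψ : IsHolonomy ψ) (h : S.edgeLabels φ = S.edgeLabels ψ) :
    ∃ κ : S.Space → G, ψ = gaugeHol κ φ := by
  obtain ⟨θ, -, hθ⟩ := S.toOneComplex.exists_gauge (hφ.comp S.cellAttachment.incl)
    (hψ.comp S.cellAttachment.incl) fun e => (congrFun h e).symm
  -- Off the 1-skeleton the gauge is set to `1`; `κ` corrects it there.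
  let Θ : S.Space → G := Function.extend S.cellAttachment.incl θ 1
  have hΘ : ∀ x, Θ (S.cellAttachment.incl x) = θ x :=
    fun x => S.cellAttachment.incl_injective.extend_apply θ 1 x
  obtain ⟨κ, hκ⟩ := S.exists_gauge (hφ.gauge Θ) hψ fun α => by
    refine (congrFun hθ α).trans ?_
    simp [gaugeHol, hΘ]
  exact ⟨κ * Θ, hκ.trans (gaugeHol_mul _ _ _)⟩

/-- Holonomies are gauge equivalent if and only if their edge labels are. -/
theorem exists_gauge_iff {φ ψ : C(I, S.Space) → G} (hφ : IsHolonomy φ) (hψ : IsHolonomy ψ) :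
    (∃ κ : S.Space → G, ψ = gaugeHol κ φ) ↔
      ∃ k : V → G, S.gaugeAct k (S.edgeLabels φ) = S.edgeLabels ψ := by
  constructor
  · rintro ⟨κ, rfl⟩
    exact ⟨_, (edgeLabels_gauge κ φ).symm⟩
  · rintro ⟨k, hk⟩
    let f : V → S.Space := fun v => S.cellAttachment.incl (S.vertex v)
    have hf : Function.Injective f :=
      S.cellAttachment.incl_injective.comp S.toOneComplex.vertex_injective
    obtain ⟨κ, hκ⟩ := exists_gauge_of_edgeLabels_eq (hφ.gauge (Function.extend f k 1)) hψ (by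
      rw [edgeLabels_gauge, ← hk]
      congr 1
      exact funext fun v => hf.extend_apply k 1 v)
    exact ⟨_, hκ.trans (gaugeHol_mul _ _ _)⟩

/-- Flat labellings up to gauge transformations are homomorphisms from the fundamental group up
to conjugation. -/
theorem exists_flat_to_homModAd [ConnectedSpace S.Space] (C : SmoothQDCode S) (x₀ : S.Space) :
    ∃ q : {g : E → G // C.IsFlat g} → HomModAd (FundamentalGroup S.Space x₀) G,
      Function.Surjective q ∧ ∀ a b, q a = q b ↔ ∃ k : V → G, S.gaugeAct k a.1 = b.1 := by
  have : PathConnectedSpace S.Space := pathConnectedSpace_iff_connectedSpace.2 inferInstance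
  have hex := fun a : {g : E → G // C.IsFlat g} => exists_edgeLabels_eq C a.2
  choose φ hφ hlab using hex
  refine ⟨fun a => Quotient.mk _ ((hφ a).toHom x₀), ?_, ?_⟩
  · intro θ
    induction θ using Quotient.inductionOn with | _ θ
    obtain ⟨χ, hχ, hθ⟩ := exists_isHolonomy_toHom x₀ θ
    refine ⟨⟨S.edgeLabels χ, isFlat_edgeLabels C hχ⟩, Quotient.sound ?_⟩
    obtain ⟨κ, hκ⟩ := exists_gauge_of_edgeLabels_eq (hφ ⟨S.edgeLabels χ, isFlat_edgeLabels C hχ⟩)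
      hχ (hlab _)
    exact (adSetoid _ G).trans ((hφ _).toHom_gauge hχ hκ x₀) hθ
  · intro a b
    rw [Quotient.eq, ← hlab a, ← hlab b, ← exists_gauge_iff (hφ a) (hφ b)]
    exact ⟨fun h => (hφ a).exists_gauge_of_toHom (hφ b) h,
      fun ⟨κ, hκ⟩ => (hφ a).toHom_gauge (hφ b) hκ x₀⟩

end TwoComplex

/-! ### The codespace -/

theorem zOperator_eq_filter {G E : Type*} [Group G] (K : Subgroup G) (l : List (E × Bool))
    [DecidablePred fun g : E → G => groupWord g l ∈ K] (ψ : QuditSpace G E) :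
    zOperator K l ψ = ψ.filter fun g => groupWord g l ∈ K := by
  induction ψ using Finsupp.induction_linear with
  | zero => rw [map_zero, Finsupp.filter_zero]
  | add f g hf hg => rw [map_add, hf, hg, Finsupp.filter_add]
  | single g c =>
    by_cases h : groupWord g l ∈ K
    · simp [zOperator, h, Finsupp.filter_single_of_pos]
    · simp [zOperator, h, Finsupp.filter_single_of_neg]

theorem zOperator_eq_self_iff {G E : Type*} [Group G] (K : Subgroup G) (l : List (E × Bool))
    (ψ : QuditSpace G E) : zOperator K l ψ = ψ ↔ ∀ g, groupWord g l ∉ K → ψ g = 0 := by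
  classical
  rw [zOperator_eq_filter, Finsupp.filter_eq_self_iff]
  exact forall_congr' fun g => not_imp_comm

namespace SmoothQDCode

variable {V E F G : Type*} [Group G] {S : TwoComplex V E F} (C : SmoothQDCode S)

-- The check permutes the basis by the gauge transformation that is `h` at `v` and `1` elsewhere.
open Classical in
theorem xCheck_eq_self_iff (v : V) (h : G) (ψ : QuditSpace G E) :
    C.xCheck v h ψ = ψ ↔ ∀ g, ψ (S.gaugeAct (Function.update 1 v h) g) = ψ g := by
  have hx : C.xCheck v h ψ = ψ.mapDomain (S.gaugeAct (Function.update 1 v h)) := by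
    change ψ.mapDomain _ = _
    congr 1
    funext g q
    simp [OneComplex.gaugeAct, Function.update_apply]
  have hinv : ∀ k : V → G, Function.LeftInverse (S.gaugeAct (k⁻¹)) (S.gaugeAct (E := E) k) := by
    intro k g
    rw [← S.gaugeAct_mul, inv_mul_cancel, S.gaugeAct_one]
  have hinj : Function.Injective (S.gaugeAct (E := E) (Function.update (1 : V → G) v h)) :=
    (hinv _).injective
  rw [hx]
  constructor
  · intro e g
    conv_lhs => rw [← e]
    exact Finsupp.mapDomain_apply hinj ψ g
  · intro e
    ext g
    have hg := hinv (Function.update (1 : V → G) v h)⁻¹ g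
    rw [inv_inv] at hg
    rw [← hg, Finsupp.mapDomain_apply hinj, e]

/-- The codespace consists of the gauge invariant vectors that are supported on the flat
labellings. -/
theorem mem_codespace_iff [Finite E] (ψ : QuditSpace G E) :
    ψ ∈ C.codespace G ↔
      (∀ (k : V → G) (g : E → G), ψ (S.gaugeAct k g) = ψ g) ∧ ∀ g, ¬ C.IsFlat g → ψ g = 0 := by
  classical
  have hdef : ψ ∈ C.codespace G ↔
      (∀ v (h : G), C.xCheck v h ψ = ψ) ∧ ∀ p, C.zCheck G p ψ = ψ := by
    constructor
    · exact fun h => ⟨fun v g => h _ (.inl ⟨v, g, rfl⟩), fun p => h _ (.inr ⟨p, rfl⟩)⟩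
    · rintro ⟨h1, h2⟩ _ (⟨v, g, rfl⟩ | ⟨p, rfl⟩)
      exacts [h1 v g, h2 p]
  rw [hdef]
  refine and_congr ?_ ?_
  · simp only [xCheck_eq_self_iff]
    refine ⟨fun h k g => ?_, fun h v x g => h _ g⟩
    -- `V` may be infinite, but a gauge transformation acts only through the finitely many end
    -- points of edges, so finitely many vertex checks compose to it.
    have key : ∀ (A : Finset V) (g : E → G),
        ψ (S.gaugeAct (fun v => if v ∈ A then k v else 1) g) = ψ g := by
      intro A
      induction A using Finset.induction_on with
      | empty => intro g; exact congrArg ψ (S.gaugeAct_one g)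
      | insert a A ha ih =>
        intro g
        have hmul : (fun v => if v ∈ insert a A then k v else 1) =
            Function.update (1 : V → G) a (k a) * fun v => if v ∈ A then k v else 1 := by
          funext v
          by_cases hv : v = a
          · subst hv; simp [ha]
          · simp [hv]
        rw [hmul, S.gaugeAct_mul, h, ih]
    have := Fintype.ofFinite E
    rw [← key (Finset.univ.image S.src ∪ Finset.univ.image S.tgt) g]
    congr 1
    funext q
    simp [OneComplex.gaugeAct]
  · simp only [zCheck, zOperator_eq_self_iff, Subgroup.mem_bot, IsFlat, not_forall]
    exact ⟨fun h g ⟨p, hp⟩ => h p g hp, fun h p g hp => h g ⟨p, hp⟩⟩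

/-- The codespace has a basis labelled by the gauge equivalence classes of flat labellings. -/
theorem nonempty_linearEquiv_codespace [Finite E] [Finite G] {Q : Type*}
    (q : {g : E → G // C.IsFlat g} → Q) (hq : Function.Surjective q)
    (hqk : ∀ a b, q a = q b ↔ ∃ k : V → G, S.gaugeAct k a.1 = b.1) :
    Nonempty (C.codespace G ≃ₗ[ℂ] (Q →₀ ℂ)) := by
  classical
  have : Finite Q := Finite.of_surjective q hq
  -- Functions on orbits are pulled back to flat labellings and extended by zero; since `Q` is
  -- finite, they are the same as formal combinations.
  let T : (Q → ℂ) →ₗ[ℂ] C.codespace G :=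
    { toFun := fun f => ⟨Finsupp.equivFunOnFinite.symm fun g =>
          if h : C.IsFlat g then f (q ⟨g, h⟩) else 0, by
        rw [C.mem_codespace_iff]
        refine ⟨fun k g => ?_, fun g hg => dif_neg hg⟩
        by_cases h : C.IsFlat g
        · have h' := (C.isFlat_gaugeAct_iff k g).2 h
          simp only [Finsupp.equivFunOnFinite_symm_apply_apply, dif_pos h, dif_pos h']
          exact congrArg f ((hqk _ _).2 ⟨k, rfl⟩).symm
        · have h' := mt (C.isFlat_gaugeAct_iff k g).1 h
          simp only [Finsupp.equivFunOnFinite_symm_apply_apply, dif_neg h, dif_neg h']⟩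
      map_add' := fun f f' => by
        ext g
        by_cases h : C.IsFlat g <;> simp [h]
      map_smul' := fun c f => by
        ext g
        by_cases h : C.IsFlat g <;> simp [h] }
  have hT : ∀ f g (h : C.IsFlat g), (T f : QuditSpace G E) g = f (q ⟨g, h⟩) :=
    fun f g h => dif_pos h
  refine ⟨(LinearEquiv.ofBijective T ⟨?_, ?_⟩).symm.trans
    (Finsupp.linearEquivFunOnFinite ℂ ℂ Q).symm⟩
  · intro f f' hf
    funext x
    obtain ⟨⟨g, hg⟩, rfl⟩ := hq x
    rw [← hT f g hg, ← hT f' g hg, hf]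
  · rintro ⟨ψ, hψ⟩
    rw [C.mem_codespace_iff] at hψ
    choose r hr using hq
    refine ⟨fun x => ψ (r x).1, Subtype.ext (Finsupp.ext fun g => ?_)⟩
    by_cases h : C.IsFlat g
    · obtain ⟨k, hk⟩ := (hqk _ _).1 (hr (q ⟨g, h⟩))
      rw [hT _ g h]
      dsimp only
      rw [← hψ.1 k, hk]
    · exact (dif_neg h).trans (hψ.2 g h).symm

end SmoothQDCode

end

theorem mainTheorem5 {G : Type*} [Group G] [Finite G]
    {V E F : Type*} [Finite E] (S : TwoComplex V E F) [ConnectedSpace S.Space]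
    (C : SmoothQDCode S) (x₀ : S.Space) :
    Nonempty (C.codespace G ≃ₗ[ℂ] (HomModAd (FundamentalGroup S.Space x₀) G →₀ ℂ)) := by
  obtain ⟨q, hq, hqk⟩ := TwoComplex.exists_flat_to_homModAd (G := G) C x₀
  exact C.nonempty_linearEquiv_codespace q hq hqk
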